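/- Let $m\ge1$ be an integer. Let $D([0,1]^m)$ be the space of all functions $f:[0,1]^m\to\mathbb R$ such that for every $t=(t_1,\dots,t_m)\in[0,1]^m$ the limit of $f(u)$ as $u\to t$ exists as a finite real number in each octant $J_1\times\dots\times J_m$, where each $J_i$ is either $[t_i,1]$ or $[0,t_i)$ (the latter only if $t_i>0$). Equip it with the norm $\|f\|=\sup_{t}|f(t)|$ and with the $\sigma$-field $\mathcal D$ generated by the point evaluations $f\mapsto f(t)$, $t\in[0,1]^m$. For real $s>0$ write $s=n+\alpha$ with $n\ge0$ an integer and $0<\alpha\le1$. For random variables $X,Y$ with values in a real Banach space $B$, possibly defined on different probability spaces, the Zolotarev distance is $$\zeta_s(X,Y)=\sup_{f}\bigl|\mathbb E f(X)-\mathbb E f(Y)\bigr|\in[0,\infty],$$ where $f$ ranges over all $n$ times continuously Fréchet differentiable functions $f:B\to\mathbb R$ such that $\|D^nf(x)-D^nf(y)\|\le\|x-y\|^{\alpha}$ for all $x,y\in B$ (with the operator norm of $n$-linear forms) and such that $f(X)$ and $f(Y)$ are integrable random variables (up to null sets; $f(X)$ need not be measurable for every such $f$ when $B$ is not separable). **Theorem.**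 Let $s>0$ be real, and let $X$ and $Y$ be $\mathcal D$-measurable random variables with values in $D([0,1]^m)$ such that $\mathbb E\|X\|^s<\infty$ and $\mathbb E\|Y\|^s<\infty$. Then the following are equivalent: 1. $\zeta_s(X,Y)<\infty$; 2. for every positive integer $\ell<s$ and all $t_1,\dots,t_\ell\in[0,1]^m$, $$\mathbb E\Bigl(\prod_{i=1}^{\ell}X(t_i)\Bigr)=\mathbb E\Bigl(\prod_{i=1}^{\ell}Y(t_i)\Bigr).$$ -/

import Mathlib

open Set Filter Topology MeasureTheory
open scoped ENNReal

noncomputable section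

/-- The cube `[0,1]^m`, with its usual (product) topology. -/
abbrev Cube (m : ℕ) : Type := Fin m → unitInterval

/-- The octant `J₁ × ⋯ × J_m` at `t` in which `J_i = [0, t_i)` for `i ∈ L` and
`J_i = [t_i, 1]` for `i ∉ L`. It is empty if `t_i = 0` for some `i ∈ L`. -/
def octant {m : ℕ} (t : Cube m) (L : Set (Fin m)) : Set (Cube m) :=
  {u | ∀ i, (i ∈ L → u i < t i) ∧ (i ∉ L → t i ≤ u i)}

/-- `f : [0,1]^m → ℝ` is right-continuous with left limits: at every point `t` and in every octant
at `t` the limit of `f` at `t` exists as a finite real number. (For an empty octant the condition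
is void, so these octants are ignored.) -/
def IsCadlag {m : ℕ} (f : Cube m → ℝ) : Prop :=
  ∀ (t : Cube m) (L : Set (Fin m)), ∃ l : ℝ, Tendsto f (𝓝[octant t L] t) (𝓝 l)

lemma iUnion_octant {m : ℕ} (t : Cube m) : ⋃ L : Set (Fin m), octant t L = univ := by
  refine eq_univ_of_forall fun u => mem_iUnion.2 ⟨{i | u i < t i}, fun i => ⟨fun h => h, fun h => ?_⟩⟩
  exact not_lt.1 h

/-- Functions in `D([0,1]^m)` are bounded. -/
lemma IsCadlag.bddAbove {m : ℕ} {f : Cube m → ℝ} (hf : IsCadlag f) :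
    BddAbove (range fun t => |f t|) := by
  have loc : ∀ t : Cube m, ∃ U ∈ 𝓝 t, BddAbove ((fun t => |f t|) '' U) := by
    intro t
    have hL : ∀ L : Set (Fin m), ∃ C : ℝ, ∀ᶠ u in 𝓝[octant t L] t, |f u| ≤ C := by
      intro L
      obtain ⟨l, hl⟩ := hf t L
      exact ⟨|l| + 1, (hl.abs.eventually (gt_mem_nhds (lt_add_one |l|))).mono fun _ h => le_of_lt h⟩
    choose C hC using hL
    obtain ⟨M, hM⟩ := (Set.finite_range C).bddAbove
    have hev : ∀ᶠ u in 𝓝 t, |f u| ≤ M := by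
      rw [← nhdsWithin_univ, ← iUnion_octant t, nhdsWithin_iUnion, eventually_iSup]
      exact fun L => (hC L).mono fun u hu => hu.trans (hM ⟨L, rfl⟩)
    exact ⟨_, hev, M, by rintro _ ⟨u, hu, rfl⟩; exact hu⟩
  rw [← image_univ]
  refine isCompact_univ.induction_on (p := fun S => BddAbove ((fun t => |f t|) '' S))
    (by simp) (fun S T h hT => hT.mono (image_mono h))
    (fun S T hS hT => by rw [image_union]; exact hS.union hT) ?_
  intro t _
  obtain ⟨U, hU, hb⟩ := loc t
  exact ⟨U, mem_nhdsWithin_of_mem_nhds hU, hb⟩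

/-- The linear space of all right-continuous functions with left limits on `[0,1]^m`. -/
def cadlagSubmodule (m : ℕ) : Submodule ℝ (Cube m → ℝ) where
  carrier := {f | IsCadlag f}
  zero_mem' := fun _ _ => ⟨0, tendsto_const_nhds⟩
  add_mem' := fun hf hg t L => by
    obtain ⟨a, ha⟩ := hf t L
    obtain ⟨b, hb⟩ := hg t L
    exact ⟨a + b, ha.add hb⟩
  smul_mem' := fun c _ hf t L => by
    obtain ⟨a, ha⟩ := hf t L
    exact ⟨c * a, ha.const_mul c⟩

/-- The space `D([0,1]^m)`. This is a type of its own, so that it carries the topology of the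
supremum norm and not that of pointwise convergence. -/
def DSpace (m : ℕ) : Type := cadlagSubmodule m

namespace DSpace

variable {m : ℕ}

instance : AddCommGroup (DSpace m) := inferInstanceAs (AddCommGroup (cadlagSubmodule m))

instance : Module ℝ (DSpace m) := inferInstanceAs (Module ℝ (cadlagSubmodule m))

instance : FunLike (DSpace m) (Cube m) ℝ where
  coe f := f.1
  coe_injective _ _ h := Subtype.ext h

lemma isCadlag (f : DSpace m) : IsCadlag f := f.2

/-- The supremum norm `‖f‖ = sup_t |f t|`. -/
instance : Norm (DSpace m) := ⟨fun f => ⨆ t, |f t|⟩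

lemma norm_def (f : DSpace m) : ‖f‖ = ⨆ t, |f t| := rfl

lemma abs_apply_le (f : DSpace m) (t : Cube m) : |f t| ≤ ‖f‖ :=
  le_ciSup f.isCadlag.bddAbove t

lemma normedSpaceCore : NormedSpace.Core ℝ (DSpace m) where
  norm_nonneg f := (abs_nonneg _).trans (f.abs_apply_le 0)
  norm_smul c f := by
    have h : ∀ t, |(c • f) t| = |c| * |f t| := fun t => abs_mul c (f t)
    simp only [norm_def, h, Real.norm_eq_abs]
    exact (Real.mul_iSup_of_nonneg (abs_nonneg c) _).symm
  norm_triangle f g :=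
    ciSup_le fun t => (abs_add_le (f t) (g t)).trans
      (add_le_add (f.abs_apply_le t) (g.abs_apply_le t))
  norm_eq_zero_iff f := by
    constructor
    · intro h
      refine DFunLike.ext _ _ fun t => ?_
      exact abs_eq_zero.1 (le_antisymm (h ▸ f.abs_apply_le t) (abs_nonneg _))
    · rintro rfl
      have h : ∀ t : Cube m, |(0 : DSpace m) t| = 0 := fun _ => abs_zero
      simp only [norm_def, h, ciSup_const]

instance : NormedAddCommGroup (DSpace m) := NormedAddCommGroup.ofCore normedSpaceCore

instance : NormedSpace ℝ (DSpace m) := NormedSpace.ofCore normedSpaceCore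

/-- The σ-field on `D([0,1]^m)` generated by the point evaluations `f ↦ f t`, `t ∈ [0,1]^m`. -/
instance : MeasurableSpace (DSpace m) :=
  ⨆ t : Cube m, MeasurableSpace.comap (fun f : DSpace m => f t) inferInstance

end DSpace

section Zolotarev

variable {B : Type*} [NormedAddCommGroup B] [NormedSpace ℝ B]

/-- For `s > 0` write `s = n + α` with `n` a nonnegative integer and `0 < α ≤ 1`, so that
`n = ⌈s⌉ - 1`. The class `F_s` consists of the `n` times continuously Fréchet differentiable
`f : B → ℝ` with `‖Dⁿf(x) - Dⁿf(y)‖ ≤ ‖x - y‖^α` for all `x, y`. -/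
def zolotarevClass (B : Type*) [NormedAddCommGroup B] [NormedSpace ℝ B] (s : ℝ) : Set (B → ℝ) :=
  {f | ContDiff ℝ (⌈s⌉₊ - 1 : ℕ) f ∧
    ∀ x y : B, ‖iteratedFDeriv ℝ (⌈s⌉₊ - 1) f x - iteratedFDeriv ℝ (⌈s⌉₊ - 1) f y‖ ≤
      ‖x - y‖ ^ (s - ((⌈s⌉₊ - 1 : ℕ) : ℝ))}

/-- The Zolotarev distance `ζ_s(X, Y) = sup |E f(X) - E f(Y)| ∈ [0, ∞]` of two `B`-valued random
variables (possibly on different probability spaces). The supremum is over all `f ∈ F_s` for which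
the two expectations exist; on a nonseparable `B` the function `f(X)` may fail to be measurable. -/
def zolotarevDist {Ω Ω' : Type*} [MeasurableSpace Ω] [MeasurableSpace Ω'] (s : ℝ)
    (P : Measure Ω) (X : Ω → B) (Q : Measure Ω') (Y : Ω' → B) : ℝ≥0∞ :=
  ⨆ f ∈ {f ∈ zolotarevClass B s |
      Integrable (fun ω => f (X ω)) P ∧ Integrable (fun ω => f (Y ω)) Q},
    ENNReal.ofReal |∫ ω, f (X ω) ∂P - ∫ ω, f (Y ω) ∂Q|

end Zolotarev

end

/-!
The distance `ζ_s` is finite exactly when the polynomials of degree less than `s` do not distinguish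
`X` from `Y`.

If `ζ_s(X, Y) < ∞`, then every multiple of a monomial `f ↦ ∏ i, f (t i)` of degree less than `s`
lies in the Zolotarev class, since its `n`-th derivative is constant; hence the two expectations
of the monomial coincide. Conversely, a function `f` in the class differs from its Taylor polynomial
of degree `n` at `0` by at most `‖x‖ ^ s`, so `ζ_s(X, Y) ≤ E‖X‖^s + E‖Y‖^s` as soon as the terms
`D^k f(0)(X, …, X)` of the Taylor polynomial are measurable and have the same expectation for `X`
and for `Y`. The point is thus that equality of the product moments of the point evaluations passes
to all bounded `k`-linear forms `g` on the nonseparable space `D([0,1]^m)`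
(`DSpace.measurable_and_integral_eq`).

For this, `f` is replaced by its composition with the map that rounds a coordinate down to a grid.
Once all coordinates in all arguments of `g` have been rounded, `g(f, …, f)` is a finite linear
combination of products of point evaluations. The rounding is removed one coordinate and one
argument at a time, along a sequence of grids, by dominated convergence. So a sequence of grids is
needed along which rounding a single coordinate of a single argument does not change `g` in the
limit, for arbitrary values of the other arguments (`DSpace.exists_grids`). Since indicator
functions of boxes `[τ, 1]` span a dense subspace (`DSpace.span_box_dense`), it is enough to
consider boxes, where rounding replaces a jump point by the next grid point to the right. This
causes no loss in the limit if `g`, as a function of one jump point, is right-continuous outside a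
countable set that does not depend on the other jump points
(`AtomBound.exists_countable_tendsto_right`): take grids that exhaust a countable dense set which
contains the exceptional points.

This countability is the heart of the matter. One-sided limits in one jump point exist because of
bounded variation, so a failure of right-continuity means that `g` has an atom. Each jump
`1_{[τ, 1]}` in another slot is a sum of the atom `1_{τ}` and of a limit of jumps at the points of a
fixed countable set. Inductively, it is enough to exclude atoms in some slots combined with jumps
from the countable set in all others, and for these the values of `g` are square summable: by a
suitable choice of signs, the sum of the squares is at most `‖g‖ ^ 2`
(`MultilinearMap.sum_sq_single_le`). Hence only countably many of them are nonzero.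
-/

noncomputable section

/-! ### Generalized limits -/

/-- The limit along a nonprincipal ultrafilter, extended linearly to unbounded sequences. -/
theorem exists_generalizedLimit :
    ∃ Lim : (ℕ → ℝ) →ₗ[ℝ] ℝ, (∀ a, Lim (fun _ => a) = a) ∧
      ∀ (f : ℕ → ℝ) (C : ℝ), (∀ᶠ n in atTop, |f n| ≤ C) → |Lim f| ≤ C := by
  set U : Ultrafilter ℕ := hyperfilter ℕ with hU
  let W : Submodule ℝ (ℕ → ℝ) :=
    { carrier := {f | ∃ a, Tendsto f U (𝓝 a)}
      zero_mem' := ⟨0, tendsto_const_nhds⟩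
      add_mem' := fun ⟨a, ha⟩ ⟨b, hb⟩ => ⟨a + b, ha.add hb⟩
      smul_mem' := fun c _ ⟨a, ha⟩ => ⟨c * a, ha.const_mul c⟩ }
  let L : W →ₗ[ℝ] ℝ :=
    { toFun := fun f => Classical.choose f.2
      map_add' := fun f g => tendsto_nhds_unique (Classical.choose_spec (f + g).2)
        ((Classical.choose_spec f.2).add (Classical.choose_spec g.2))
      map_smul' := fun c f => tendsto_nhds_unique (Classical.choose_spec (c • f).2)
        ((Classical.choose_spec f.2).const_mul c) }
  obtain ⟨Lim, hLim⟩ := LinearMap.exists_extend L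
  have key : ∀ (f : ℕ → ℝ) (a : ℝ), Tendsto f U (𝓝 a) → Lim f = a := by
    intro f a hf
    have h1 : Lim f = L ⟨f, a, hf⟩ := LinearMap.congr_fun hLim ⟨f, a, hf⟩
    rw [h1]
    exact tendsto_nhds_unique (Classical.choose_spec (⟨a, hf⟩ : ∃ a, Tendsto f U (𝓝 a))) hf
  refine ⟨Lim, fun a => key _ a tendsto_const_nhds, fun f C hf => ?_⟩
  have hfU : ∀ᶠ n in (U : Filter ℕ), f n ∈ Icc (-C) C :=
    (hf.filter_mono (Nat.cofinite_eq_atTop ▸ hyperfilter_le_cofinite)).mono fun n hn => abs_le.1 hn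
  obtain ⟨a, ha, hle⟩ := (isCompact_Icc (a := -C) (b := C)).ultrafilter_le_nhds (U.map f)
    (le_principal_iff.2 hfU)
  rw [key f a hle]
  exact abs_le.2 ha

/-- A linear functional on all real sequences that is compatible with bounds on tails; it extends
the limit of convergent sequences. -/
def generalizedLimit : (ℕ → ℝ) →ₗ[ℝ] ℝ := Classical.choose exists_generalizedLimit

lemma generalizedLimit_const (a : ℝ) : generalizedLimit (fun _ => a) = a :=
  (Classical.choose_spec exists_generalizedLimit).1 a

lemma abs_generalizedLimit_le {f : ℕ → ℝ} {C : ℝ} (h : ∀ᶠ n in atTop, |f n| ≤ C) :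
    |generalizedLimit f| ≤ C :=
  (Classical.choose_spec exists_generalizedLimit).2 f C h

lemma generalizedLimit_eq {f : ℕ → ℝ} {a : ℝ} (h : Tendsto f atTop (𝓝 a)) :
    generalizedLimit f = a := by
  have h1 : ∀ ε > 0, |generalizedLimit f - a| ≤ ε := by
    intro ε hε
    have h2 : generalizedLimit (f - fun _ => a) = generalizedLimit f - a := by
      rw [map_sub, generalizedLimit_const]
    rw [← h2]
    refine abs_generalizedLimit_le ?_
    filter_upwards [Metric.tendsto_nhds.1 h ε hε] with n hn
    exact (Real.dist_eq (f n) a ▸ hn).le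
  by_contra hne
  have hpos : 0 < |generalizedLimit f - a| := abs_pos.2 (sub_ne_zero.2 hne)
  linarith [h1 _ (half_pos hpos)]

/-! ### Square summability of bounded multilinear forms -/

section SquareSum

variable {Λ I : Type*} [Fintype Λ] [DecidableEq Λ]

/-- Choose the signs one at a time, using the parallelogram law. -/
lemma exists_signs_sum_sq_le {A : Type*} (T : Finset A) (t : Finset I) (x : I → A → ℝ) :
    ∃ ε : I → ℝ, (∀ i, |ε i| ≤ 1) ∧
      ∑ i ∈ t, ∑ a ∈ T, x i a ^ 2 ≤ ∑ a ∈ T, (∑ i ∈ t, ε i * x i a) ^ 2 := by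
  classical
  induction t using Finset.induction_on with
  | empty => exact ⟨fun _ => 1, by simp, by simp⟩
  | insert j t hj ih =>
    obtain ⟨ε, hε, h⟩ := ih
    have upd : ∀ (c : ℝ) (a : A), ∑ i ∈ insert j t, Function.update ε j c i * x i a =
        c * x j a + ∑ i ∈ t, ε i * x i a := by
      intro c a
      rw [Finset.sum_insert hj, Function.update_self]
      congr 1
      refine Finset.sum_congr rfl fun i hi => ?_
      rw [Function.update_of_ne (ne_of_mem_of_not_mem hi hj)]
    have bd : ∀ c : ℝ, |c| ≤ 1 → ∀ i, |Function.update ε j c i| ≤ 1 := by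
      intro c hc i
      by_cases hi : i = j
      · subst hi; simpa using hc
      · rw [Function.update_of_ne hi]; exact hε i
    have par : ∑ a ∈ T, (1 * x j a + ∑ i ∈ t, ε i * x i a) ^ 2 +
        ∑ a ∈ T, ((-1) * x j a + ∑ i ∈ t, ε i * x i a) ^ 2 =
        2 * (∑ a ∈ T, x j a ^ 2 + ∑ a ∈ T, (∑ i ∈ t, ε i * x i a) ^ 2) := by
      rw [← Finset.sum_add_distrib, ← Finset.sum_add_distrib, Finset.mul_sum]
      exact Finset.sum_congr rfl fun a _ => by ring
    rw [Finset.sum_insert hj]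
    by_cases hc : ∑ a ∈ T, x j a ^ 2 + ∑ a ∈ T, (∑ i ∈ t, ε i * x i a) ^ 2 ≤
        ∑ a ∈ T, (1 * x j a + ∑ i ∈ t, ε i * x i a) ^ 2
    · refine ⟨Function.update ε j 1, bd 1 (by simp), ?_⟩
      simp only [upd]
      linarith
    · refine ⟨Function.update ε j (-1), bd (-1) (by simp), ?_⟩
      simp only [upd]
      linarith

/-- If a multilinear form on finitely supported coefficients is bounded by `C` on all choices of
coefficients in `[-1, 1]`, then its values at the basis vectors are square summable. -/
lemma MultilinearMap.sum_sq_single_le (M : MultilinearMap ℝ (fun _ : Λ => I →₀ ℝ) ℝ) {C : ℝ}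
    (t : Λ → Finset I)
    (hM : ∀ ε : Λ → I → ℝ, (∀ q i, |ε q i| ≤ 1) →
      |M fun q => ∑ i ∈ t q, ε q i • Finsupp.single i 1| ≤ C) :
    ∑ τ ∈ Fintype.piFinset t, M (fun q => Finsupp.single (τ q) 1) ^ 2 ≤ C ^ 2 := by
  classical
  rcases isEmpty_or_nonempty I with hI | ⟨⟨o⟩⟩
  · rcases isEmpty_or_nonempty Λ with hΛ | ⟨⟨q⟩⟩
    · have h := hM (fun _ _ => 0) (by simp)
      have h' : ∀ v w : Λ → I →₀ ℝ, M v = M w := fun v w => by rw [Subsingleton.elim v w]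
      have hcard : (Fintype.piFinset t).card = 1 := by simp
      obtain ⟨τ, hτ⟩ := Finset.card_eq_one.1 hcard
      rw [hτ, Finset.sum_singleton, h' _ fun q => ∑ i ∈ t q, (0 : ℝ) • Finsupp.single i 1]
      exact sq_le_sq' (abs_le.1 h).1 (abs_le.1 h).2
    · have : IsEmpty (Λ → I) := ⟨fun τ => hI.elim (τ q)⟩
      rw [Finset.eq_empty_of_isEmpty (Fintype.piFinset t)]
      simpa using sq_nonneg C
  -- Sum over the slots one at a time, replacing each sum of squares by a square of a signed sum.
  have key : ∀ (s : Finset Λ) (ε : Λ → I → ℝ), (∀ q i, |ε q i| ≤ 1) →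
      ∑ τ ∈ Fintype.piFinset (fun q => if q ∈ s then t q else {o}),
        M (fun q => if q ∈ s then Finsupp.single (τ q) 1
          else ∑ i ∈ t q, ε q i • Finsupp.single i 1) ^ 2 ≤ C ^ 2 := by
    intro s
    induction s using Finset.induction_on with
    | empty =>
      intro ε hε
      have h1 : Fintype.piFinset (fun q : Λ => if q ∈ (∅ : Finset Λ) then t q else {o}) =
          {fun _ => o} := by
        ext τ
        simp [funext_iff]
      rw [h1, Finset.sum_singleton]
      simp only [Finset.notMem_empty, if_false]
      exact sq_le_sq' (abs_le.1 (hM ε hε)).1 (abs_le.1 (hM ε hε)).2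
    | insert p s hp ih =>
      intro ε hε
      set w : (Λ → I) → Λ → I →₀ ℝ := fun τ q => if q ∈ s then Finsupp.single (τ q) 1
          else ∑ i ∈ t q, ε q i • Finsupp.single i 1 with hw
      have h1 : ∑ τ ∈ Fintype.piFinset (fun q => if q ∈ insert p s then t q else {o}),
          M (fun q => if q ∈ insert p s then Finsupp.single (τ q) 1
            else ∑ i ∈ t q, ε q i • Finsupp.single i 1) ^ 2 =
          ∑ x ∈ t p ×ˢ Fintype.piFinset (fun q => if q ∈ s then t q else {o}),
            M (Function.update (w x.2) p (Finsupp.single x.1 1)) ^ 2 := by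
        refine Finset.sum_bij' (fun τ _ => (τ p, Function.update τ p o))
          (fun x _ => Function.update x.2 p x.1) ?_ ?_ ?_ ?_ ?_
        · intro τ hτ
          rw [Fintype.mem_piFinset] at hτ
          rw [Finset.mem_product, Fintype.mem_piFinset]
          refine ⟨by simpa using hτ p, fun q => ?_⟩
          by_cases hq : q = p
          · subst hq; simp [hp]
          · simpa [hq] using hτ q
        · intro x hx
          rw [Finset.mem_product, Fintype.mem_piFinset] at hx
          rw [Fintype.mem_piFinset]
          intro q
          by_cases hq : q = p
          · subst hq; simpa using hx.1
          · simpa [hq] using hx.2 q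
        · intro τ _
          simp
        · intro x hx
          rw [Finset.mem_product, Fintype.mem_piFinset] at hx
          have := hx.2 p
          simp only [hp, if_false, Finset.mem_singleton] at this
          ext1
          · simp
          · simp [← this]
        · intro τ _
          congr 2
          ext1 q
          by_cases hq : q = p
          · subst hq; simp
          · simp [hq, hw]
      rw [h1, Finset.sum_product]
      obtain ⟨η, hη, hle⟩ := exists_signs_sum_sq_le
        (Fintype.piFinset (fun q => if q ∈ s then t q else {o})) (t p)
        (fun i τ => M (Function.update (w τ) p (Finsupp.single i 1)))
      refine hle.trans ((le_of_eq ?_).trans (ih (Function.update ε p η) ?_))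
      · refine Finset.sum_congr rfl fun τ _ => ?_
        congr 1
        have h2 : (fun q => if q ∈ s then Finsupp.single (τ q) 1 else
            ∑ i ∈ t q, Function.update ε p η q i • (Finsupp.single i 1 : I →₀ ℝ)) =
            Function.update (w τ) p (∑ i ∈ t p, η i • Finsupp.single i 1) := by
          ext1 q
          by_cases hq : q = p
          · subst hq; simp [hp]
          · simp [hq, hw]
        rw [h2, M.map_update_sum]
        exact Finset.sum_congr rfl fun i _ => by rw [M.map_update_smul, smul_eq_mul]
      · intro q i
        by_cases hq : q = p
        · subst hq; simpa using hη i
        · simpa [hq] using hε q i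
  simpa using key Finset.univ (fun _ _ => 1) (by simp)

end SquareSum

/-! ### Atoms of a bounded multilinear form on step functions -/

/-- The step function `∑ c_τ 1_{[τ, 1]}` on the unit interval encoded by the coefficients `c`. -/
def stepFun : (unitInterval →₀ ℝ) →ₗ[ℝ] (unitInterval → ℝ) :=
  Finsupp.linearCombination ℝ fun τ x => if τ ≤ x then 1 else 0

lemma stepFun_apply (v : unitInterval →₀ ℝ) (x : unitInterval) :
    stepFun v x = ∑ τ ∈ v.support, v τ * if τ ≤ x then 1 else 0 := by
  simp [stepFun, Finsupp.linearCombination_apply, Finsupp.sum]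

lemma stepFun_single (τ : unitInterval) (c : ℝ) (x : unitInterval) :
    stepFun (Finsupp.single τ c) x = c * if τ ≤ x then 1 else 0 := by
  simp [stepFun]

/-- The map that replaces each jump `1_{[τ, 1]}` by the bump `1_{[τ, ρ τ)}`. -/
def bump (ρ : unitInterval → unitInterval) : (unitInterval →₀ ℝ) →ₗ[ℝ] (unitInterval →₀ ℝ) :=
  LinearMap.id - Finsupp.lmapDomain ℝ ℝ ρ

lemma bump_single (ρ : unitInterval → unitInterval) (τ : unitInterval) (c : ℝ) :
    bump ρ (Finsupp.single τ c) = Finsupp.single τ c - Finsupp.single (ρ τ) c := by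
  simp [bump, Finsupp.mapDomain_single]

lemma stepFun_bump {ρ : unitInterval → unitInterval} (hρ : ∀ τ, τ ≤ ρ τ) (v : unitInterval →₀ ℝ)
    (x : unitInterval) :
    stepFun (bump ρ v) x = ∑ τ ∈ v.support, v τ * if τ ≤ x ∧ x < ρ τ then 1 else 0 := by
  have h : bump ρ v = ∑ τ ∈ v.support, (Finsupp.single τ (v τ) - Finsupp.single (ρ τ) (v τ)) := by
    conv_lhs => rw [← Finsupp.sum_single v, Finsupp.sum, map_sum]
    simp only [bump_single]
  rw [h, map_sum, Finset.sum_apply]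
  refine Finset.sum_congr rfl fun τ _ => ?_
  rw [map_sub, Pi.sub_apply, stepFun_single, stepFun_single, ← mul_sub]
  congr 1
  by_cases h1 : τ ≤ x <;> by_cases h2 : ρ τ ≤ x
  · simp [h1, h2]
  · simp [h1, h2, not_le.1 h2]
  · exact absurd ((hρ τ).trans h2) h1
  · simp [h1, h2]

/-- Shrinking bumps at finitely many points are eventually disjoint. -/
lemma eventually_abs_stepFun_bump_le {ρ : ℕ → unitInterval → unitInterval}
    (hρ : ∀ n τ, τ ≤ ρ n τ) (hlim : ∀ τ, Tendsto (fun n => ρ n τ) atTop (𝓝 τ))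
    {v : unitInterval →₀ ℝ} (hv : ∀ τ, |v τ| ≤ 1) :
    ∀ᶠ n in atTop, ∀ x, |stepFun (bump (ρ n) v) x| ≤ 1 := by
  have h1 : ∀ᶠ n in atTop, ∀ τ ∈ v.support, ∀ τ' ∈ v.support, τ < τ' → ρ n τ < τ' := by
    rw [Finset.eventually_all]
    intro τ _
    rw [Finset.eventually_all]
    intro τ' _
    by_cases h : τ < τ'
    · exact ((hlim τ).eventually (gt_mem_nhds h)).mono fun n hn _ => hn
    · exact Eventually.of_forall fun n hn => absurd hn h
  filter_upwards [h1] with n hn x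
  rw [stepFun_bump (hρ n)]
  by_cases hx : ∃ τ ∈ v.support, τ ≤ x ∧ x < ρ n τ
  · obtain ⟨τ, hτ, hτx, hxτ⟩ := hx
    rw [Finset.sum_eq_single_of_mem τ hτ]
    · simpa [hτx, hxτ] using hv τ
    · intro τ' hτ' hne
      rw [if_neg, mul_zero]
      rintro ⟨h2, h3⟩
      rcases lt_or_gt_of_ne hne with h | h
      · exact absurd (h3.trans (hn τ' hτ' τ hτ h)) (not_lt.2 hτx)
      · exact absurd (hxτ.trans (hn τ hτ τ' hτ' h)) (not_lt.2 h2)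
  · rw [Finset.sum_eq_zero]
    · simp
    · intro τ hτ
      rw [if_neg fun h => hx ⟨τ, hτ, h⟩, mul_zero]

section Atoms

variable {Λ : Type*} [DecidableEq Λ]

/-- The form obtained from `M` by replacing in slot `q` the jumps `1_{[τ, 1]}` by the atoms
"`1_{τ}`", that is by the generalized limit of the bumps `1_{[τ, ρ n τ)}` as `n → ∞`. -/
def atomForm (ρ : ℕ → unitInterval → unitInterval) (q : Λ)
    (M : MultilinearMap ℝ (fun _ : Λ => unitInterval →₀ ℝ) ℝ) :
    MultilinearMap ℝ (fun _ : Λ => unitInterval →₀ ℝ) ℝ :=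
  generalizedLimit.compMultilinearMap (MultilinearMap.pi fun n =>
    M.compLinearMap fun q' => if q' = q then bump (ρ n) else LinearMap.id)

lemma atomForm_apply (ρ : ℕ → unitInterval → unitInterval) (q : Λ)
    (M : MultilinearMap ℝ (fun _ : Λ => unitInterval →₀ ℝ) ℝ) (v : Λ → unitInterval →₀ ℝ) :
    atomForm ρ q M v =
      generalizedLimit fun n => M (Function.update v q (bump (ρ n) (v q))) := by
  simp only [atomForm, LinearMap.compMultilinearMap_apply]
  congr 1
  ext n
  simp only [MultilinearMap.pi_apply, MultilinearMap.compLinearMap_apply]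
  congr 1
  ext1 q'
  by_cases h : q' = q
  · subst h; simp
  · simp [h]

lemma atomForm_single (ρ : ℕ → unitInterval → unitInterval) (q : Λ)
    (M : MultilinearMap ℝ (fun _ : Λ => unitInterval →₀ ℝ) ℝ) (τ : Λ → unitInterval) :
    atomForm ρ q M (fun r => Finsupp.single (τ r) 1) =
      generalizedLimit fun n => M (fun r => Finsupp.single (τ r) 1) -
        M (fun r => Finsupp.single (Function.update τ q (ρ n (τ q)) r) 1) := by
  rw [atomForm_apply]
  congr 1
  ext n
  rw [bump_single, M.map_update_sub]
  congr 2
  · exact Function.update_eq_self _ _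
  · ext1 r
    by_cases h : r = q
    · subst h; simp
    · simp [h]

/-- The form with atoms in the slots of the list `l` and jumps in all other slots. -/
def atomForms (ρ : ℕ → unitInterval → unitInterval)
    (M : MultilinearMap ℝ (fun _ : Λ => unitInterval →₀ ℝ) ℝ) (l : List Λ) :
    MultilinearMap ℝ (fun _ : Λ => unitInterval →₀ ℝ) ℝ :=
  l.foldr (atomForm ρ) M

/-- `|M v| ≤ C` whenever `v q` has coefficients at most `1` in the slots `q ∈ l` and encodes a step
function bounded by `1` in the other slots. -/
def AtomBound (M : MultilinearMap ℝ (fun _ : Λ => unitInterval →₀ ℝ) ℝ) (l : List Λ) (C : ℝ) :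
    Prop :=
  ∀ v : Λ → unitInterval →₀ ℝ, (∀ q ∈ l, ∀ τ, |v q τ| ≤ 1) →
    (∀ q ∉ l, ∀ x, |stepFun (v q) x| ≤ 1) → |M v| ≤ C

variable {ρ : ℕ → unitInterval → unitInterval}
  {M : MultilinearMap ℝ (fun _ : Λ => unitInterval →₀ ℝ) ℝ} {C : ℝ}

/-- Passing from jumps to atoms in a slot preserves the bound `C`, since the bumps that define the
atoms are eventually disjoint. -/
lemma AtomBound.atomForms (hρ : ∀ n τ, τ ≤ ρ n τ)
    (hlim : ∀ τ, Tendsto (fun n => ρ n τ) atTop (𝓝 τ)) (hM : AtomBound M [] C) :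
    ∀ {l : List Λ}, l.Nodup → AtomBound (atomForms ρ M l) l C
  | [], _ => hM
  | q :: l, hl => by
    intro v hv hv'
    rw [List.nodup_cons] at hl
    change |atomForm ρ q (_root_.atomForms ρ M l) v| ≤ C
    rw [atomForm_apply]
    refine abs_generalizedLimit_le ?_
    filter_upwards [eventually_abs_stepFun_bump_le hρ hlim (hv q (by simp))] with n hn
    refine AtomBound.atomForms hρ hlim hM hl.2 _ (fun r hr τ => ?_) fun r hr x => ?_
    · have hrq : r ≠ q := ne_of_mem_of_not_mem hr hl.1
      rw [Function.update_of_ne hrq]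
      exact hv r (List.mem_cons_of_mem _ hr) τ
    · by_cases hrq : r = q
      · subst hrq
        rw [Function.update_self]
        exact hn x
      · rw [Function.update_of_ne hrq]
        exact hv' r (by simp [hrq, hr]) x

variable [Fintype Λ]

/-- With the jump points outside `l` fixed, only countably many tuples of atoms in the slots of `l`
are charged, by square summability. -/
lemma AtomBound.countable {l : List Λ} (hM : AtomBound M l C) (r : Λ → unitInterval) :
    {τ : Λ → unitInterval | (∀ q ∉ l, τ q = r q) ∧
      M (fun q => Finsupp.single (τ q) 1) ≠ 0}.Countable := by
  classical
  set f : (Λ → unitInterval) → ℝ := fun τ =>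
    if ∀ q ∉ l, τ q = r q then M (fun q => Finsupp.single (τ q) 1) ^ 2 else 0 with hf
  have hf0 : ∀ τ, 0 ≤ f τ := fun τ => by
    simp only [hf]; split_ifs <;> positivity
  have hsum : Summable f := by
    refine summable_of_sum_le hf0 (c := C ^ 2) fun u => ?_
    set u' := u.filter fun τ => ∀ q ∉ l, τ q = r q with hu'
    set t : Λ → Finset unitInterval := fun q => u'.image fun τ => τ q with ht
    have htr : ∀ q ∉ l, ∀ i ∈ t q, i = r q := by
      intro q hq i hi
      obtain ⟨τ, hτ, rfl⟩ := Finset.mem_image.1 hi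
      exact (Finset.mem_filter.1 hτ).2 q hq
    have h1 : ∑ τ ∈ u, f τ = ∑ τ ∈ u', M (fun q => Finsupp.single (τ q) 1) ^ 2 := by
      rw [hu', Finset.sum_filter]
    rw [h1]
    refine (Finset.sum_le_sum_of_subset_of_nonneg (t := Fintype.piFinset t) (fun τ hτ => ?_)
      fun _ _ _ => sq_nonneg _).trans (M.sum_sq_single_le t fun ε hε => ?_)
    · exact Fintype.mem_piFinset.2 fun q => Finset.mem_image_of_mem _ hτ
    · refine hM _ (fun q _ τ => ?_) fun q hq x => ?_
      · rw [Finsupp.finsetSum_apply]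
        simp only [Finsupp.smul_apply, Finsupp.single_apply, smul_eq_mul, mul_ite, mul_one,
          mul_zero, Finset.sum_ite_eq']
        split_ifs
        · exact hε q τ
        · simp
      · have hsub : t q ⊆ {r q} := fun i hi => Finset.mem_singleton.2 (htr q hq i hi)
        rcases Finset.subset_singleton_iff.1 hsub with h | h
        · simp [h]
        · rw [h, Finset.sum_singleton, map_smul, Pi.smul_apply, stepFun_single, smul_eq_mul,
            one_mul]
          split_ifs
          · simpa using hε q (r q)
          · simp
  refine hsum.countable_support.mono fun τ hτ => ?_
  simp only [Function.mem_support, hf, if_pos hτ.1]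
  exact pow_ne_zero 2 hτ.2

/-- Outside a countable set of points, a bounded form has no atoms in a given slot, whatever the
jumps or atoms in the other slots. -/
theorem AtomBound.exists_countable (hM : AtomBound M [] C) {Q : Set unitInterval}
    (hQ : Q.Countable) (hρ : ∀ n τ, τ ≤ ρ n τ)
    (hlim : ∀ τ, Tendsto (fun n => ρ n τ) atTop (𝓝 τ)) (hρQ : ∀ n τ, ρ n τ ∈ Q) :
    ∃ A : Set unitInterval, A.Countable ∧ ∀ (l : List Λ), l.Nodup → ∀ p ∈ l,
      ∀ τ : Λ → unitInterval, τ p ∉ A →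
        _root_.atomForms ρ M l (fun q => Finsupp.single (τ q) 1) = 0 := by
  classical
  have : Countable Q := hQ.to_subtype
  set Z : List Λ → (Λ → Q) → Set (Λ → unitInterval) := fun l r =>
    {τ | l.Nodup ∧ (∀ q ∉ l, τ q = r q) ∧
      _root_.atomForms ρ M l (fun q => Finsupp.single (τ q) 1) ≠ 0} with hZ
  have hZc : ∀ l r, (Z l r).Countable := by
    intro l r
    by_cases hl : l.Nodup
    · exact ((hM.atomForms hρ hlim hl).countable fun q => (r q : unitInterval)).mono
        fun τ hτ => hτ.2
    · exact countable_empty.mono fun τ hτ => absurd hτ.1 hl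
  refine ⟨⋃ (p : Λ) (l : List Λ) (r : Λ → Q), (fun τ => τ p) '' Z l r,
    countable_iUnion fun p => countable_iUnion fun l => countable_iUnion fun r =>
      (hZc l r).image _, ?_⟩
  -- Induction on the number of slots that carry a jump outside `Q`.
  have key : ∀ (c : ℕ) (l : List Λ), l.Nodup → ∀ p ∈ l, ∀ τ : Λ → unitInterval,
      τ p ∉ ⋃ (p : Λ) (l : List Λ) (r : Λ → Q), (fun τ => τ p) '' Z l r →
      (Finset.univ.filter fun q => q ∉ l ∧ τ q ∉ Q).card = c →
      _root_.atomForms ρ M l (fun q => Finsupp.single (τ q) 1) = 0 := by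
    intro c
    induction c with
    | zero =>
      intro l hl p hp τ hτ hc
      by_contra hne
      have hQ' : ∀ q ∉ l, τ q ∈ Q := by
        intro q hq
        by_contra h
        have := Finset.card_eq_zero.1 hc
        exact Finset.notMem_empty q (this ▸ Finset.mem_filter.2 ⟨Finset.mem_univ _, hq, h⟩)
      have hne' : Nonempty Q := ⟨⟨ρ 0 0, hρQ 0 0⟩⟩
      refine hτ (mem_iUnion.2 ⟨p, mem_iUnion.2 ⟨l, mem_iUnion.2
        ⟨fun q => if h : τ q ∈ Q then ⟨τ q, h⟩ else Classical.arbitrary Q, τ, ⟨hl, ?_, hne⟩, rfl⟩⟩⟩)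
      intro q hq
      simp [hQ' q hq]
    | succ c ih =>
      intro l hl p hp τ hτ hc
      obtain ⟨q, hq⟩ := Finset.card_pos.1 (hc.symm ▸ Nat.succ_pos c :
        0 < (Finset.univ.filter fun q => q ∉ l ∧ τ q ∉ Q).card)
      obtain ⟨hql, hqQ⟩ := (Finset.mem_filter.1 hq).2
      have h1 := ih (q :: l) (List.nodup_cons.2 ⟨hql, hl⟩) p (List.mem_cons_of_mem _ hp) τ hτ (by
        have : (Finset.univ.filter fun r => r ∉ q :: l ∧ τ r ∉ Q) =
            (Finset.univ.filter fun r => r ∉ l ∧ τ r ∉ Q).erase q := by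
          ext r
          simp only [List.mem_cons, not_or, Finset.mem_filter, Finset.mem_univ, true_and,
            Finset.mem_erase]
          tauto
        rw [this, Finset.card_erase_of_mem hq, hc, Nat.add_sub_cancel])
      have h2 : ∀ n, _root_.atomForms ρ M l
          (fun r => Finsupp.single (Function.update τ q (ρ n (τ q)) r) 1) = 0 := by
        intro n
        refine ih l hl p hp _ ?_ ?_
        · rwa [Function.update_of_ne (ne_of_mem_of_not_mem hp hql)]
        · have : (Finset.univ.filter fun r => r ∉ l ∧ Function.update τ q (ρ n (τ q)) r ∉ Q) =
              (Finset.univ.filter fun r => r ∉ l ∧ τ r ∉ Q).erase q := by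
            ext r
            simp only [Finset.mem_filter, Finset.mem_univ, true_and, Finset.mem_erase]
            by_cases hr : r = q
            · subst hr; simp [hρQ]
            · simp [hr]
          rw [this, Finset.card_erase_of_mem hq, hc, Nat.add_sub_cancel]
      change atomForm ρ q (_root_.atomForms ρ M l) _ = 0 at h1
      rw [atomForm_single] at h1
      simp only [h2, sub_zero, generalizedLimit_const] at h1
      exact h1
  exact fun l hl p hp τ hτ => key _ l hl p hp τ hτ rfl

end Atoms

/-! ### Right-continuity in the jump points -/

section RightContinuity

variable {Λ : Type*} [DecidableEq Λ] {M : MultilinearMap ℝ (fun _ : Λ => unitInterval →₀ ℝ) ℝ}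
  {C : ℝ}

lemma single_update (τ : Λ → unitInterval) (p : Λ) (s : unitInterval) :
    (fun q => (Finsupp.single (Function.update τ p s q) 1 : unitInterval →₀ ℝ)) =
      Function.update (fun q => Finsupp.single (τ q) 1) p (Finsupp.single s 1) := by
  ext1 q
  by_cases h : q = p
  · subst h; simp
  · simp [h]

/-- A signed sum of differences of consecutive jumps is a step function bounded by `1`. -/
lemma AtomBound.boundedVariationOn (hM : AtomBound M [] C) (τ : Λ → unitInterval) (p : Λ) :
    BoundedVariationOn (fun s => M fun q => Finsupp.single (Function.update τ p s q) 1) univ := by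
  set h : unitInterval → ℝ := fun s => M fun q => Finsupp.single (Function.update τ p s q) 1 with hh
  have hbd : eVariationOn h univ ≤ ENNReal.ofReal C := by
    refine iSup_le fun ⟨n, u, hu, _⟩ => ?_
    simp only [edist_dist, Real.dist_eq]
    rw [← ENNReal.ofReal_sum_of_nonneg fun _ _ => abs_nonneg _]
    refine ENNReal.ofReal_le_ofReal ?_
    have hsign : ∀ i, ∃ ε : ℝ, |ε| = 1 ∧
        ε * (h (u (i + 1)) - h (u i)) = |h (u (i + 1)) - h (u i)| := by
      intro i
      rcases abs_choice (h (u (i + 1)) - h (u i)) with h1 | h1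
      · exact ⟨1, by simp, by rw [h1, one_mul]⟩
      · exact ⟨-1, by simp, by rw [h1, neg_one_mul]⟩
    choose ε hε hεh using hsign
    set v : Λ → unitInterval →₀ ℝ := fun q => Finsupp.single (τ q) 1 with hv
    have h1 : ∑ i ∈ Finset.range n, |h (u (i + 1)) - h (u i)| =
        M (Function.update v p (∑ i ∈ Finset.range n,
          ε i • (Finsupp.single (u (i + 1)) 1 - Finsupp.single (u i) 1))) := by
      rw [M.map_update_sum]
      refine Finset.sum_congr rfl fun i _ => ?_
      rw [M.map_update_smul, M.map_update_sub, ← hεh, smul_eq_mul]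
      simp only [hh, single_update, hv]
    rw [h1]
    refine (le_abs_self _).trans (hM _ (by simp) fun q _ x => ?_)
    by_cases hq : q = p
    · subst hq
      rw [Function.update_self, map_sum, Finset.sum_apply]
      have h2 : ∀ i, |stepFun (ε i • (Finsupp.single (u (i + 1)) 1 - Finsupp.single (u i) 1)) x| =
          (if u i ≤ x then 1 else 0) - (if u (i + 1) ≤ x then 1 else 0) := by
        intro i
        have hi := hu (Nat.le_succ i)
        rw [map_smul, map_sub, Pi.smul_apply, Pi.sub_apply, stepFun_single, stepFun_single,
          smul_eq_mul, abs_mul, hε]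
        by_cases ha : u (i + 1) ≤ x
        · simp [ha, hi.trans ha]
        · by_cases hb : u i ≤ x <;> simp [ha, hb]
      refine (Finset.abs_sum_le_sum_abs _ _).trans ?_
      rw [Finset.sum_congr rfl fun i _ => h2 i, Finset.sum_range_sub']
      split_ifs <;> norm_num
    · rw [Function.update_of_ne hq, hv, stepFun_single]
      split_ifs <;> simp
  exact ne_top_of_le_ne_top ENNReal.ofReal_ne_top hbd

/-- Right approximations `ρ n τ → τ` by points of a countable set. The point `1`, which has nothing
to its right, is approximated by itself. -/
lemma exists_countable_approx_right :
    ∃ (Q : Set unitInterval) (ρ : ℕ → unitInterval → unitInterval), Q.Countable ∧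
      (∀ n τ, ρ n τ ∈ Q) ∧ (∀ n τ, τ < 1 → τ < ρ n τ) ∧ (∀ n τ, τ ≤ ρ n τ) ∧
      ∀ τ, Tendsto (fun n => ρ n τ) atTop (𝓝 τ) := by
  obtain ⟨D, hDc, hD⟩ := TopologicalSpace.exists_countable_dense unitInterval
  have h : ∀ τ : unitInterval, ∃ u : ℕ → unitInterval, (∀ n, u n ∈ insert 1 D) ∧
      (∀ n, τ < 1 → τ < u n) ∧ (∀ n, τ ≤ u n) ∧ Tendsto u atTop (𝓝 τ) := by
    intro τ
    by_cases hτ : τ < 1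
    · obtain ⟨u, -, hu, hlim⟩ := hD.exists_seq_strictAnti_tendsto_of_lt hτ
      exact ⟨u, fun n => mem_insert_of_mem _ (hu n).2, fun n _ => (hu n).1.1,
        fun n => (hu n).1.1.le, hlim⟩
    · have h1 : τ = 1 := le_antisymm unitInterval.le_one' (not_lt.1 hτ)
      subst h1
      exact ⟨fun _ => 1, fun _ => mem_insert _ _, fun _ h => h, fun _ => le_rfl,
        tendsto_const_nhds⟩
  choose u hu using h
  exact ⟨insert 1 D, fun n τ => u τ n, hDc.insert 1, fun n τ => (hu τ).1 n,
    fun n τ => (hu τ).2.1 n, fun n τ => (hu τ).2.2.1 n, fun τ => (hu τ).2.2.2⟩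

/-- As a function of its jump points, a bounded form on step functions is right-continuous in each
slot outside a countable set that does not depend on the jump points in the other slots. -/
theorem AtomBound.exists_countable_tendsto_right [Fintype Λ] (hM : AtomBound M [] C) :
    ∃ A : Set unitInterval, A.Countable ∧ ∀ (τ : Λ → unitInterval) (p : Λ), τ p ∉ A →
      Tendsto (fun s => M fun q => Finsupp.single (Function.update τ p s q) 1) (𝓝[>] (τ p))
        (𝓝 (M fun q => Finsupp.single (τ q) 1)) := by
  obtain ⟨Q, ρ, hQ, hρQ, hρlt, hρ, hlim⟩ := exists_countable_approx_right
  obtain ⟨A, hA, hzero⟩ := hM.exists_countable hQ hρ hlim hρQ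
  refine ⟨A, hA, fun τ p hp => ?_⟩
  rcases eq_or_lt_of_le (unitInterval.le_one' (t := τ p)) with h1 | h1
  · have : Ioi (τ p) = ∅ := by
      rw [h1]; exact Set.eq_empty_of_forall_notMem fun x hx => not_lt.2 unitInterval.le_one' hx
    rw [this, nhdsWithin_empty]
    exact tendsto_bot
  · have h2 := (hM.boundedVariationOn τ p).tendsto_rightLim (τ p)
    set L := Function.rightLim
      (fun s => M fun q => Finsupp.single (Function.update τ p s q) 1) (τ p) with hL
    have h3 : Tendsto (fun n => ρ n (τ p)) atTop (𝓝[>] (τ p)) :=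
      tendsto_nhdsWithin_iff.2 ⟨hlim _, Eventually.of_forall fun n => hρlt n _ h1⟩
    have h4 := hzero [p] (by simp) p (by simp) τ hp
    change atomForm ρ p M _ = 0 at h4
    have h5 : Tendsto (fun n => M (fun r => Finsupp.single (τ r) 1) -
        M (fun r => Finsupp.single (Function.update τ p (ρ n (τ p)) r) 1)) atTop
        (𝓝 (M (fun r => Finsupp.single (τ r) 1) - L)) := (h2.comp h3).const_sub _
    rw [atomForm_single, generalizedLimit_eq h5] at h4
    rwa [sub_eq_zero.1 h4]

end RightContinuity

/-! ### Grids -/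

lemma eventually_le_iff_lt (g t : unitInterval) : ∀ᶠ x in 𝓝[<] t, (g ≤ x ↔ g < t) := by
  by_cases h : g < t
  · filter_upwards [nhdsWithin_le_nhds (lt_mem_nhds h)] with x hx
    exact ⟨fun _ => h, fun _ => hx.le⟩
  · filter_upwards [self_mem_nhdsWithin] with x hx
    exact ⟨fun h' => h'.trans_lt hx, fun h' => absurd h' h⟩

lemma eventually_le_iff_le (g t : unitInterval) : ∀ᶠ x in 𝓝[≥] t, (g ≤ x ↔ g ≤ t) := by
  by_cases h : g ≤ t
  · filter_upwards [self_mem_nhdsWithin] with x hx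
    exact ⟨fun _ => h, fun _ => h.trans hx⟩
  · filter_upwards [nhdsWithin_le_nhds (gt_mem_nhds (not_le.1 h))] with x hx
    exact ⟨fun h' => absurd hx (not_lt.2 h'), fun h' => absurd h' h⟩

/-- The largest point of the grid `G ∪ {0}` that is at most `x`. -/
def gridMap (G : Finset unitInterval) (x : unitInterval) : unitInterval :=
  (G.filter (· ≤ x)).sup id

lemma gridMap_mem (G : Finset unitInterval) (x : unitInterval) : gridMap G x ∈ insert ⊥ G := by
  rcases (G.filter (· ≤ x)).eq_empty_or_nonempty with h | h
  · simp [gridMap, h]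
  · obtain ⟨y, hy, hyx⟩ := Finset.exists_mem_eq_sup _ h id
    rw [gridMap, hyx]
    exact Finset.mem_insert_of_mem (Finset.mem_filter.1 hy).1

lemma le_gridMap_iff {G : Finset unitInterval} {τ : unitInterval} (hτ : ⊥ < τ) (x : unitInterval) :
    τ ≤ gridMap G x ↔ ∃ g ∈ G, g ≤ x ∧ τ ≤ g := by
  simp [gridMap, Finset.le_sup_iff hτ, and_assoc]

lemma lt_gridMap_iff {G : Finset unitInterval} {τ : unitInterval} (x : unitInterval) :
    τ < gridMap G x ↔ ∃ g ∈ G, g ≤ x ∧ τ < g := by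
  simp [gridMap, Finset.lt_sup_iff, and_assoc]

lemma le_gridMap_iff_of_mem {G : Finset unitInterval} {g : unitInterval} (hg : g ∈ insert ⊥ G)
    (x : unitInterval) : g ≤ gridMap G x ↔ g ≤ x := by
  rcases eq_bot_or_bot_lt g with h | h
  · simp [h]
  · rw [le_gridMap_iff h]
    constructor
    · rintro ⟨g', -, h1, h2⟩
      exact h2.trans h1
    · exact fun hx => ⟨g, (Finset.mem_insert.1 hg).resolve_left h.ne', hx, le_rfl⟩

/-- Rounding down the argument of `1_{[τ, 1]}` moves the jump to the next grid point on its
right. -/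
lemma exists_le_gridMap_iff {G : Finset unitInterval} (hG : 1 ∈ G) (τ : unitInterval) :
    ∃ τ', τ ≤ τ' ∧ (∀ g ∈ G, τ ≤ g → τ' ≤ g) ∧ ∀ x, τ ≤ gridMap G x ↔ τ' ≤ x := by
  rcases eq_bot_or_bot_lt τ with h | h
  · exact ⟨⊥, by simp [h], by simp, by simp [h]⟩
  · have hne : (G.filter (τ ≤ ·)).Nonempty :=
      ⟨1, Finset.mem_filter.2 ⟨hG, unitInterval.le_one'⟩⟩
    have hmem := Finset.mem_filter.1 ((G.filter (τ ≤ ·)).min'_mem hne)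
    refine ⟨(G.filter (τ ≤ ·)).min' hne, hmem.2,
      fun g hg hτg => Finset.min'_le _ _ (Finset.mem_filter.2 ⟨hg, hτg⟩), fun x => ?_⟩
    rw [le_gridMap_iff h]
    constructor
    · rintro ⟨g, hg, h1, h2⟩
      exact (Finset.min'_le _ _ (Finset.mem_filter.2 ⟨hg, h2⟩)).trans h1
    · exact fun hx => ⟨_, hmem.1, hx, hmem.2⟩

lemma exists_eventually_gridMap_eq_left (G : Finset unitInterval) (t : unitInterval) :
    ∃ c, ∀ᶠ x in 𝓝[<] t, gridMap G x = c := by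
  refine ⟨(G.filter (· < t)).sup id, ?_⟩
  have h : ∀ᶠ x in 𝓝[<] t, ∀ g ∈ G, (g ≤ x ↔ g < t) :=
    (Finset.eventually_all G).2 fun g _ => eventually_le_iff_lt g t
  filter_upwards [h] with x hx
  rw [gridMap, Finset.filter_congr hx]

lemma eventually_gridMap_eq_right (G : Finset unitInterval) (t : unitInterval) :
    ∀ᶠ x in 𝓝[≥] t, gridMap G x = gridMap G t := by
  have h : ∀ᶠ x in 𝓝[≥] t, ∀ g ∈ G, (g ≤ x ↔ g ≤ t) :=
    (Finset.eventually_all G).2 fun g _ => eventually_le_iff_le g t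
  filter_upwards [h] with x hx
  rw [gridMap, Finset.filter_congr hx, gridMap]

lemma exists_eventually_stepFun_eq_left (v : unitInterval →₀ ℝ) (t : unitInterval) :
    ∃ c, ∀ᶠ x in 𝓝[<] t, stepFun v x = c := by
  refine ⟨∑ τ ∈ v.support, v τ * if τ < t then 1 else 0, ?_⟩
  have h : ∀ᶠ x in 𝓝[<] t, ∀ g ∈ v.support, (g ≤ x ↔ g < t) :=
    (Finset.eventually_all _).2 fun g _ => eventually_le_iff_lt g t
  filter_upwards [h] with x hx
  rw [stepFun_apply]
  exact Finset.sum_congr rfl fun τ hτ => by simp only [hx τ hτ]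

lemma eventually_stepFun_eq_right (v : unitInterval →₀ ℝ) (t : unitInterval) :
    ∀ᶠ x in 𝓝[≥] t, stepFun v x = stepFun v t := by
  have h : ∀ᶠ x in 𝓝[≥] t, ∀ g ∈ v.support, (g ≤ x ↔ g ≤ t) :=
    (Finset.eventually_all _).2 fun g _ => eventually_le_iff_le g t
  filter_upwards [h] with x hx
  rw [stepFun_apply, stepFun_apply]
  exact Finset.sum_congr rfl fun τ hτ => by simp only [hx τ hτ]

lemma exists_stepFun_eq_indicator (G : Finset unitInterval) {p : unitInterval}
    (hp : p ∈ insert ⊥ G) :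
    ∃ v : unitInterval →₀ ℝ, ∀ x, stepFun v x = if gridMap G x = p then 1 else 0 := by
  have hle := le_gridMap_iff_of_mem hp
  rcases (G.filter (p < ·)).eq_empty_or_nonempty with h | hne
  · refine ⟨Finsupp.single p 1, fun x => ?_⟩
    have hlt : ¬ p < gridMap G x := by
      rw [lt_gridMap_iff]
      rintro ⟨g, hg, -, hpg⟩
      exact Finset.notMem_empty g (h ▸ Finset.mem_filter.2 ⟨hg, hpg⟩)
    rw [stepFun_single, one_mul]
    refine if_congr ?_ rfl rfl
    rw [← hle]
    exact ⟨fun h1 => le_antisymm (not_lt.1 hlt) h1, fun h1 => h1.ge⟩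
  · have hmem := Finset.mem_filter.1 ((G.filter (p < ·)).min'_mem hne)
    set b := (G.filter (p < ·)).min' hne with hb
    have hlt : ∀ x, p < gridMap G x ↔ b ≤ x := by
      intro x
      rw [lt_gridMap_iff]
      constructor
      · rintro ⟨g, hg, h1, h2⟩
        exact (Finset.min'_le _ _ (Finset.mem_filter.2 ⟨hg, h2⟩)).trans h1
      · exact fun hx => ⟨_, hmem.1, hx, hmem.2⟩
    refine ⟨Finsupp.single p 1 - Finsupp.single b 1, fun x => ?_⟩
    rw [map_sub, Pi.sub_apply, stepFun_single, stepFun_single, one_mul, one_mul]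
    rw [if_congr (hle x).symm rfl rfl, if_congr (hlt x).symm rfl rfl]
    rcases lt_trichotomy p (gridMap G x) with h | h | h
    · rw [if_pos h.le, if_pos h, if_neg h.ne', sub_self]
    · rw [if_pos h.le, if_neg h.not_lt, if_pos h.symm, sub_zero]
    · rw [if_neg (not_le.2 h), if_neg h.not_gt, if_neg h.ne, sub_zero]

/-- The identity or, for a grid, the rounding map of the grid. -/
def coordMap : Option (Finset unitInterval) → unitInterval → unitInterval
  | none => id
  | some G => gridMap G

/-- A coordinate map sends one-sided neighbourhoods to one-sided neighbourhoods; here `b` tells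
whether the left side at `t` is sent to the left side at `t'`. -/
lemma coordMap_tendsto_left (o : Option (Finset unitInterval)) (t : unitInterval) :
    ∃ (t' : unitInterval) (b : Prop), (b → Tendsto (coordMap o) (𝓝[<] t) (𝓝[<] t')) ∧
      (¬ b → Tendsto (coordMap o) (𝓝[<] t) (𝓝[≥] t')) := by
  cases o with
  | none => exact ⟨t, True, fun _ => tendsto_id, fun h => absurd trivial h⟩
  | some G =>
    obtain ⟨c, hc⟩ := exists_eventually_gridMap_eq_left G t
    refine ⟨c, False, fun h => h.elim, fun _ => tendsto_nhdsWithin_iff.2 ⟨?_, ?_⟩⟩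
    · exact tendsto_const_nhds.congr' (hc.mono fun x hx => hx.symm)
    · exact hc.mono fun x hx => hx.ge

lemma coordMap_tendsto_right (o : Option (Finset unitInterval)) (t : unitInterval) :
    Tendsto (coordMap o) (𝓝[≥] t) (𝓝[≥] (coordMap o t)) := by
  cases o with
  | none => exact tendsto_id
  | some G =>
    have hc := eventually_gridMap_eq_right G t
    refine tendsto_nhdsWithin_iff.2 ⟨?_, ?_⟩
    · exact tendsto_const_nhds.congr' (hc.mono fun x hx => hx.symm)
    · exact hc.mono fun x hx => hx.ge

/-! ### Operations on right-continuous functions with left limits -/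

section Cadlag

variable {m : ℕ}

lemma tendsto_octant_iff {β : Type*} {l : Filter β} {φ : β → Cube m} {t : Cube m}
    {L : Set (Fin m)} :
    Tendsto φ l (𝓝[octant t L] t) ↔ ∀ i, (i ∈ L → Tendsto (fun b => φ b i) l (𝓝[<] (t i))) ∧
      (i ∉ L → Tendsto (fun b => φ b i) l (𝓝[≥] (t i))) := by
  classical
  have h : octant t L = Set.pi univ fun i => if i ∈ L then Iio (t i) else Ici (t i) := by
    ext u
    simp only [octant, mem_ofPred_eq, mem_univ_pi]
    refine forall_congr' fun i => ?_
    by_cases hi : i ∈ L <;> simp [hi]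
  rw [h, nhdsWithin_pi_univ_eq, tendsto_iInf]
  refine forall_congr' fun i => ?_
  rw [tendsto_comap_iff]
  by_cases hi : i ∈ L <;> simp [hi, Function.comp_def]

lemma tendsto_apply_left {t : Cube m} {L : Set (Fin m)} {i : Fin m} (hi : i ∈ L) :
    Tendsto (fun x : Cube m => x i) (𝓝[octant t L] t) (𝓝[<] (t i)) :=
  (tendsto_octant_iff.1 tendsto_id i).1 hi

lemma tendsto_apply_right {t : Cube m} {L : Set (Fin m)} {i : Fin m} (hi : i ∉ L) :
    Tendsto (fun x : Cube m => x i) (𝓝[octant t L] t) (𝓝[≥] (t i)) :=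
  (tendsto_octant_iff.1 tendsto_id i).2 hi

lemma IsCadlag.comp_coordMap {f : Cube m → ℝ} (hf : IsCadlag f)
    (c : Fin m → Option (Finset unitInterval)) :
    IsCadlag fun x => f fun i => coordMap (c i) (x i) := by
  intro t L
  have h : ∀ i, ∃ (t' : unitInterval) (b : Prop),
      (b → Tendsto (fun x : Cube m => coordMap (c i) (x i)) (𝓝[octant t L] t) (𝓝[<] t')) ∧
      (¬ b → Tendsto (fun x : Cube m => coordMap (c i) (x i)) (𝓝[octant t L] t) (𝓝[≥] t')) := by
    intro i
    by_cases hi : i ∈ L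
    · obtain ⟨t', b, h1, h2⟩ := coordMap_tendsto_left (c i) (t i)
      exact ⟨t', b, fun hb => (h1 hb).comp (tendsto_apply_left hi),
        fun hb => (h2 hb).comp (tendsto_apply_left hi)⟩
    · exact ⟨coordMap (c i) (t i), False, fun hb => hb.elim,
        fun _ => (coordMap_tendsto_right (c i) (t i)).comp (tendsto_apply_right hi)⟩
  choose t' b hl hr using h
  obtain ⟨a, ha⟩ := hf t' {i | b i}
  exact ⟨a, ha.comp (tendsto_octant_iff.2 fun i => ⟨hl i, hr i⟩)⟩

lemma exists_eventually_eq_of_sides {α : Type*} {φ : unitInterval → α}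
    (hl : ∀ t, ∃ c, ∀ᶠ x in 𝓝[<] t, φ x = c) (hr : ∀ t, ∀ᶠ x in 𝓝[≥] t, φ x = φ t)
    (t : Cube m) (L : Set (Fin m)) (i : Fin m) :
    ∃ c, ∀ᶠ x in 𝓝[octant t L] t, φ (x i) = c := by
  by_cases hi : i ∈ L
  · obtain ⟨c, hc⟩ := hl (t i)
    exact ⟨c, (tendsto_apply_left hi).eventually hc⟩
  · exact ⟨φ (t i), (tendsto_apply_right hi).eventually (hr (t i))⟩

/-- Any function of the rounded coordinates is right-continuous with left limits. -/
lemma isCadlag_comp_gridMap (F : Cube m → ℝ) (G : Fin m → Finset unitInterval) :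
    IsCadlag fun x => F fun i => gridMap (G i) (x i) := by
  intro t L
  choose c hc using fun i => exists_eventually_eq_of_sides (exists_eventually_gridMap_eq_left (G i))
    (eventually_gridMap_eq_right (G i)) t L i
  refine ⟨F c, tendsto_const_nhds.congr' ?_⟩
  filter_upwards [eventually_all.2 hc] with x hx
  rw [show (fun i => gridMap (G i) (x i)) = c from funext hx]

lemma isCadlag_prod_stepFun (v : Fin m → unitInterval →₀ ℝ) :
    IsCadlag fun x => ∏ i, stepFun (v i) (x i) := by
  intro t L
  choose c hc using fun i => exists_eventually_eq_of_sides (exists_eventually_stepFun_eq_left (v i))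
    (eventually_stepFun_eq_right (v i)) t L i
  refine ⟨∏ i, c i, tendsto_const_nhds.congr' ?_⟩
  filter_upwards [eventually_all.2 hc] with x hx
  exact Finset.prod_congr rfl fun i _ => (hx i).symm

namespace DSpace

/-- The element of `D([0,1]^m)` given by a right-continuous function with left limits. -/
def ofFun (f : Cube m → ℝ) (hf : IsCadlag f) : DSpace m := ⟨f, hf⟩

lemma sub_apply (f g : DSpace m) (x : Cube m) : (f - g) x = f x - g x := rfl

lemma smul_apply (c : ℝ) (f : DSpace m) (x : Cube m) : (c • f) x = c * f x := rfl

lemma norm_le_of_abs_apply_le {f : DSpace m} {C : ℝ} (h : ∀ x, |f x| ≤ C) : ‖f‖ ≤ C := by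
  rw [norm_def]
  exact ciSup_le h

/-- The evaluation of the elements of `D([0,1]^m)` at a point. -/
def evalCLM (x : Cube m) : DSpace m →L[ℝ] ℝ :=
  LinearMap.mkContinuous
    { toFun := fun f => f x
      map_add' := fun _ _ => rfl
      map_smul' := fun _ _ => rfl } 1 fun f => by
    rw [one_mul]; exact f.abs_apply_le x

lemma sum_apply {ι : Type*} (s : Finset ι) (f : ι → DSpace m) (x : Cube m) :
    (∑ i ∈ s, f i) x = ∑ i ∈ s, f i x :=
  map_sum (evalCLM x) f s

lemma measurable_apply (x : Cube m) : Measurable fun f : DSpace m => f x :=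
  Measurable.of_comap_le (le_iSup (fun t : Cube m =>
    MeasurableSpace.comap (fun f : DSpace m => f t) inferInstance) x)

/-- The composition of the elements of `D([0,1]^m)` with the map that acts on the coordinate `i` by
`coordMap (c i)`. -/
def compCLM (c : Fin m → Option (Finset unitInterval)) : DSpace m →L[ℝ] DSpace m :=
  LinearMap.mkContinuous
    { toFun := fun f => ofFun (fun x => f fun i => coordMap (c i) (x i))
        (f.isCadlag.comp_coordMap c)
      map_add' := fun _ _ => rfl
      map_smul' := fun _ _ => rfl } 1 fun f => by
    rw [one_mul]
    exact norm_le_of_abs_apply_le fun x => f.abs_apply_le _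

lemma compCLM_apply (c : Fin m → Option (Finset unitInterval)) (f : DSpace m) (x : Cube m) :
    compCLM c f x = f fun i => coordMap (c i) (x i) := rfl

lemma norm_compCLM_le (c : Fin m → Option (Finset unitInterval)) : ‖compCLM c‖ ≤ 1 :=
  LinearMap.mkContinuous_norm_le _ zero_le_one _

/-- The tensor product `x ↦ ∏ i, φ i (x i)` of one-dimensional step functions. -/
def prodStep : MultilinearMap ℝ (fun _ : Fin m => unitInterval →₀ ℝ) (DSpace m) where
  toFun v := ofFun (fun x => ∏ i, stepFun (v i) (x i)) (isCadlag_prod_stepFun v)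
  map_update_add' v i a b := by
    refine DFunLike.ext _ _ fun x => ?_
    exact ((MultilinearMap.mkPiAlgebra ℝ (Fin m) ℝ).compLinearMap fun j =>
      (LinearMap.proj (x j)).comp stepFun).map_update_add v i a b
  map_update_smul' v i c a := by
    refine DFunLike.ext _ _ fun x => ?_
    exact ((MultilinearMap.mkPiAlgebra ℝ (Fin m) ℝ).compLinearMap fun j =>
      (LinearMap.proj (x j)).comp stepFun).map_update_smul v i c a

lemma prodStep_apply (v : Fin m → unitInterval →₀ ℝ) (x : Cube m) :
    prodStep v x = ∏ i, stepFun (v i) (x i) := rfl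

/-- The indicator function of the box `[τ_1, 1] × ⋯ × [τ_m, 1]`. -/
def box (τ : Cube m) : DSpace m := prodStep fun i => Finsupp.single (τ i) 1

lemma box_apply (τ x : Cube m) : box τ x = if ∀ i, τ i ≤ x i then 1 else 0 := by
  simp only [box, prodStep_apply, stepFun_single, one_mul]
  by_cases h : ∀ i, τ i ≤ x i
  · simp [h]
  · rw [if_neg h]
    obtain ⟨i, hi⟩ := not_forall.1 h
    exact Finset.prod_eq_zero (Finset.mem_univ i) (if_neg hi)

lemma prodStep_mem_span (v : Fin m → unitInterval →₀ ℝ) :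
    prodStep v ∈ Submodule.span ℝ (range (box (m := m))) := by
  classical
  have h : v = fun i => ∑ τ ∈ (v i).support, (v i τ) • Finsupp.single τ 1 := by
    ext1 i
    conv_lhs => rw [← Finsupp.sum_single (v i), Finsupp.sum]
    exact Finset.sum_congr rfl fun τ _ => by simp
  rw [h, MultilinearMap.map_sum_finset]
  refine Submodule.sum_mem _ fun τ _ => ?_
  rw [MultilinearMap.map_smul_univ]
  exact Submodule.smul_mem _ _ (Submodule.subset_span ⟨τ, rfl⟩)

end DSpace

/-! ### Density of step functions -/

/-- Arbitrarily small neighbourhoods are unions of cells of a finite grid, a cell consisting of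
points that lie to the right of the same grid points. -/
lemma exists_saturated_nhds {t : unitInterval} {s : Set unitInterval} (hs : s ∈ 𝓝 t) :
    ∃ (G : Finset unitInterval) (W : Set unitInterval), W ∈ 𝓝 t ∧ W ⊆ s ∧
      ∀ x ∈ W, ∀ y, (∀ g ∈ G, g ≤ x ↔ g ≤ y) → y ∈ W := by
  obtain ⟨b, c, htbc, hbc, hsub⟩ := exists_Icc_mem_subset_of_mem_nhds hs
  refine ⟨{b, c}, {x | b ≤ x ∧ (c ≤ x → c = ⊤)}, ?_, fun x hx => hsub ⟨hx.1, ?_⟩, ?_⟩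
  · by_cases hc : c = ⊤
    · filter_upwards [hbc] with x hx
      exact ⟨hx.1, fun _ => hc⟩
    · have htc : t < c := by
        refine lt_of_le_of_ne htbc.2 ?_
        rintro rfl
        obtain ⟨u, htu⟩ : ∃ u, t < u := ⟨⊤, lt_top_iff_ne_top.2 hc⟩
        obtain ⟨v, hv, hv'⟩ := exists_Ico_subset_of_mem_nhds hbc ⟨u, htu⟩
        obtain ⟨w, hw⟩ := exists_between hv
        exact absurd (hv' ⟨hw.1.le, hw.2⟩).2 (not_le.2 hw.1)
      filter_upwards [hbc, gt_mem_nhds htc] with x hx hxc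
      exact ⟨hx.1, fun h => absurd hxc (not_lt.2 h)⟩
  · by_contra h
    exact h (hx.2 (not_le.1 h).le ▸ le_top)
  · intro x hx y hy
    have hb := hy b (by simp)
    have hc := hy c (by simp)
    exact ⟨hb.1 hx.1, fun h => hx.2 (hc.2 h)⟩

/-- A right-continuous function with left limits oscillates by at most `ε` on the cells of some
finite grid. -/
lemma IsCadlag.exists_grid {f : Cube m → ℝ} (hf : IsCadlag f) {ε : ℝ} (hε : 0 < ε) :
    ∃ G : Finset unitInterval, ∀ x y : Cube m, (∀ i, ∀ g ∈ G, g ≤ x i ↔ g ≤ y i) →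
      |f x - f y| ≤ ε := by
  classical
  suffices h : ∃ G : Finset unitInterval, ∀ x ∈ (univ : Set (Cube m)), ∀ y : Cube m,
      (∀ i, ∀ g ∈ G, g ≤ x i ↔ g ≤ y i) → |f x - f y| ≤ ε by
    obtain ⟨G, hG⟩ := h
    exact ⟨G, fun x => hG x (mem_univ x)⟩
  refine isCompact_univ.induction_on (p := fun S => ∃ G : Finset unitInterval, ∀ x ∈ S,
    ∀ y : Cube m, (∀ i, ∀ g ∈ G, g ≤ x i ↔ g ≤ y i) → |f x - f y| ≤ ε) ⟨∅, by simp⟩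
    (fun S T hST ⟨G, hG⟩ => ⟨G, fun x hx => hG x (hST hx)⟩) ?_ ?_
  · rintro S T ⟨G, hG⟩ ⟨G', hG'⟩
    refine ⟨G ∪ G', fun x hx y hy => ?_⟩
    rcases hx with hx | hx
    · exact hG x hx y fun i g hg => hy i g (Finset.mem_union_left _ hg)
    · exact hG' x hx y fun i g hg => hy i g (Finset.mem_union_right _ hg)
  · intro t _
    choose l hl using hf t
    have h1 : ∀ᶠ u in 𝓝 t, ∀ L : Set (Fin m), u ∈ octant t L → |f u - l L| < ε / 2 := by
      refine eventually_all.2 fun L => eventually_nhdsWithin_iff.1 ?_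
      filter_upwards [Metric.tendsto_nhds.1 (hl L) _ (half_pos hε)] with u hu
      rwa [← Real.dist_eq]
    rw [nhds_pi] at h1
    obtain ⟨J, -, s, hs, hsub⟩ := Filter.mem_pi.1 h1
    choose G W hW hWs hsat using fun i => exists_saturated_nhds (hs i)
    refine ⟨Set.pi univ W, mem_nhdsWithin_of_mem_nhds (set_pi_mem_nhds finite_univ fun i _ => hW i),
      Finset.univ.biUnion fun i => insert (t i) (G i), fun x hx y hy => ?_⟩
    have hG : ∀ i, ∀ g ∈ insert (t i) (G i), (g ≤ x i ↔ g ≤ y i) := fun i g hg =>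
      hy i g (Finset.mem_biUnion.2 ⟨i, Finset.mem_univ i, hg⟩)
    have hyW : ∀ i, y i ∈ W i := fun i => hsat i (x i) (hx i (mem_univ i)) (y i) fun g hg =>
      hG i g (Finset.mem_insert_of_mem hg)
    set L : Set (Fin m) := {i | x i < t i} with hL
    have hxL : x ∈ octant t L := fun i => ⟨fun h => h, fun h => not_lt.1 h⟩
    have hyL : y ∈ octant t L := fun i => by
      have := hG i (t i) (Finset.mem_insert_self _ _)
      constructor
      · intro h
        rw [hL, mem_ofPred_eq, ← not_le, this, not_le] at h
        exact h
      · intro h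
        exact this.1 (not_lt.1 h)
    have h2 := hsub (fun i _ => hWs i (hx i (mem_univ i)) : x ∈ J.pi s) L hxL
    have h3 := hsub (fun i _ => hWs i (hyW i) : y ∈ J.pi s) L hyL
    rw [abs_lt] at h2 h3
    rw [abs_le]
    constructor <;> linarith

namespace DSpace

theorem span_box_dense : (Submodule.span ℝ (range (box (m := m)))).topologicalClosure = ⊤ := by
  classical
  rw [eq_top_iff]
  intro f _
  rw [← SetLike.mem_coe, Submodule.topologicalClosure_coe, Metric.mem_closure_iff]
  intro ε hε
  obtain ⟨G, hG⟩ := f.isCadlag.exists_grid (half_pos hε)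
  have hv : ∀ p : unitInterval, ∃ v : unitInterval →₀ ℝ, p ∈ insert ⊥ G →
      ∀ x, stepFun v x = if gridMap G x = p then 1 else 0 := by
    intro p
    by_cases hp : p ∈ insert ⊥ G
    · obtain ⟨v, hv⟩ := exists_stepFun_eq_indicator G hp
      exact ⟨v, fun _ => hv⟩
    · exact ⟨0, fun h => absurd h hp⟩
  choose v hv using hv
  refine ⟨∑ p ∈ Fintype.piFinset fun _ : Fin m => insert ⊥ G, f p • prodStep fun i => v (p i),
    Submodule.sum_mem _ fun p _ => Submodule.smul_mem _ _ (prodStep_mem_span _), ?_⟩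
  rw [dist_eq_norm]
  refine (norm_le_of_abs_apply_le fun x => ?_).trans_lt (half_lt_self hε)
  have h1 : (∑ p ∈ Fintype.piFinset fun _ : Fin m => insert ⊥ G,
      f p • prodStep fun i => v (p i)) x = f fun i => gridMap G (x i) := by
    rw [sum_apply, Finset.sum_eq_single (fun i => gridMap G (x i))]
    · rw [smul_apply, prodStep_apply, Finset.prod_eq_one, mul_one]
      intro i _
      rw [hv _ (gridMap_mem G (x i)), if_pos rfl]
    · intro p hp hne
      obtain ⟨i, hi⟩ := Function.ne_iff.1 hne
      rw [smul_apply, prodStep_apply, Finset.prod_eq_zero (Finset.mem_univ i), mul_zero]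
      rw [hv _ (Fintype.mem_piFinset.1 hp i), if_neg (Ne.symm hi)]
    · intro h
      exact absurd (Fintype.mem_piFinset.2 fun i => gridMap_mem G (x i)) h
  rw [sub_apply, h1]
  exact hG _ _ fun i g hg => (le_gridMap_iff_of_mem (Finset.mem_insert_of_mem hg) _).symm

end DSpace

end Cadlag

/-! ### Approximation of multilinear forms along grids -/

/-- A bounded sequence of multilinear forms tends to zero pointwise if it does so when all arguments
are taken from a set that spans a dense subspace. -/
lemma ContinuousMultilinearMap.tendsto_zero_of_dense {ι E : Type*} [Fintype ι] [DecidableEq ι]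
    [NormedAddCommGroup E] [NormedSpace ℝ E]
    {h : ℕ → ContinuousMultilinearMap ℝ (fun _ : ι => E) ℝ} {C : ℝ} (hC : ∀ n, ‖h n‖ ≤ C)
    {S : Set E} (hS : (Submodule.span ℝ S).topologicalClosure = ⊤)
    (H : ∀ v : ι → E, (∀ i, v i ∈ S) → Tendsto (fun n => h n v) atTop (𝓝 0)) (v : ι → E) :
    Tendsto (fun n => h n v) atTop (𝓝 0) := by
  suffices key : ∀ (s : Finset ι) (v : ι → E), (∀ i ∉ s, v i ∈ S) →
      Tendsto (fun n => h n v) atTop (𝓝 0) from key Finset.univ v (by simp)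
  intro s
  induction s using Finset.induction_on with
  | empty => exact fun v hv => H v fun i => hv i (by simp)
  | insert p s hp ih =>
    intro v hv
    let W : Submodule ℝ E :=
      { carrier := {w | Tendsto (fun n => h n (Function.update v p w)) atTop (𝓝 0)}
        zero_mem' := by
          have h0 : ∀ n, h n (Function.update v p 0) = 0 := fun n => (h n).map_update_zero v p
          simp only [mem_ofPred_eq, h0]
          exact tendsto_const_nhds
        add_mem' := fun {a b} ha hb => by
          simp only [mem_ofPred_eq, (h _).map_update_add] at *
          simpa using! ha.add hb
        smul_mem' := fun c a ha => by
          simp only [mem_ofPred_eq, (h _).map_update_smul] at *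
          simpa using! ha.const_smul c }
    have hSW : Submodule.span ℝ S ≤ W := by
      refine Submodule.span_le.2 fun w hw => ih _ fun i hi => ?_
      by_cases hip : i = p
      · subst hip; simpa using hw
      · rw [Function.update_of_ne hip]
        exact hv i (by simp [hip, hi])
    set K : ℝ := C * ∏ l ∈ Finset.univ.erase p, ‖v l‖ with hK
    have hC0 : 0 ≤ C := (norm_nonneg _).trans (hC 0)
    have hK0 : 0 ≤ K := mul_nonneg hC0 (Finset.prod_nonneg fun _ _ => norm_nonneg _)
    have hbound : ∀ n w, ‖h n (Function.update v p w)‖ ≤ K * ‖w‖ := by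
      intro n w
      refine ((h n).le_of_opNorm_le (hC n) _).trans (le_of_eq ?_)
      rw [← Finset.mul_prod_erase Finset.univ _ (Finset.mem_univ p), Function.update_self,
        Finset.prod_congr rfl fun l hl => by
          rw [Function.update_of_ne (Finset.ne_of_mem_erase hl)], hK]
      ring
    rw [Metric.tendsto_atTop]
    intro ε hε
    have hvp : v p ∈ closure (Submodule.span ℝ S : Set E) := by
      rw [← Submodule.topologicalClosure_coe, hS]; trivial
    obtain ⟨w, hw, hdist⟩ := Metric.mem_closure_iff.1 hvp (ε / 2 / (K + 1)) (by positivity)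
    obtain ⟨N, hN⟩ := Metric.tendsto_atTop.1
      (hSW hw : Tendsto (fun n => h n (Function.update v p w)) atTop (𝓝 0)) (ε / 2) (half_pos hε)
    refine ⟨N, fun n hn => ?_⟩
    have h1 : h n v = h n (Function.update v p (v p - w)) + h n (Function.update v p w) := by
      rw [← (h n).map_update_add, sub_add_cancel, Function.update_eq_self]
    have h2 := hN n hn
    rw [dist_zero_right] at h2 ⊢
    rw [dist_eq_norm] at hdist
    have h3 : K * ‖v p - w‖ ≤ ε / 2 := by
      rw [lt_div_iff₀ (by positivity)] at hdist
      nlinarith [norm_nonneg (v p - w)]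
    rw [h1]
    calc _ ≤ _ + _ := norm_add_le _ _
      _ < ε := by linarith [hbound n (v p - w)]

section Grids

variable {m k : ℕ}

namespace DSpace

/-- The multilinear form in the `k m` one-dimensional factors that a `k`-linear form on
`D([0,1]^m)` defines through tensor products of step functions. -/
def jumpForm (g : ContinuousMultilinearMap ℝ (fun _ : Fin k => DSpace m) ℝ) :
    MultilinearMap ℝ (fun _ : (_ : Fin k) × Fin m => unitInterval →₀ ℝ) ℝ :=
  g.toMultilinearMap.compMultilinearMap fun _ => prodStep

lemma jumpForm_single (g : ContinuousMultilinearMap ℝ (fun _ : Fin k => DSpace m) ℝ)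
    (τ : (_ : Fin k) × Fin m → unitInterval) :
    jumpForm g (fun q => Finsupp.single (τ q) 1) = g fun i => box fun j => τ ⟨i, j⟩ := rfl

lemma jumpForm_atomBound (g : ContinuousMultilinearMap ℝ (fun _ : Fin k => DSpace m) ℝ) :
    AtomBound (jumpForm g) [] ‖g‖ := by
  intro v _ hv
  have h : ∀ i, ‖prodStep fun j => v ⟨i, j⟩‖ ≤ 1 := by
    intro i
    refine norm_le_of_abs_apply_le fun x => ?_
    rw [prodStep_apply, Finset.abs_prod]
    exact Finset.prod_le_one (fun _ _ => abs_nonneg _) fun j _ => hv ⟨i, j⟩ (by simp) (x j)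
  refine (g.le_opNorm fun i => prodStep fun j => v ⟨i, j⟩).trans ?_
  exact mul_le_of_le_one_right (norm_nonneg _)
    (Finset.prod_le_one (fun _ _ => norm_nonneg _) fun i _ => h i)

end DSpace

/-- A sequence of finite grids that exhausts `A` and becomes dense. -/
lemma exists_grid_sequence {A : Set unitInterval} (hA : A.Countable) :
    ∃ G : ℕ → Finset unitInterval, (∀ n, 1 ∈ G n) ∧ (∀ a ∈ A, ∀ᶠ n in atTop, a ∈ G n) ∧
      ∀ t u : unitInterval, t < u → ∀ᶠ n in atTop, ∃ a ∈ G n, t < a ∧ a < u := by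
  obtain ⟨D, hDc, hD⟩ := TopologicalSpace.exists_countable_dense unitInterval
  obtain ⟨e, he⟩ := ((hA.union hDc).insert 1).exists_eq_range ⟨1, mem_insert _ _⟩
  have hmem : ∀ a ∈ A ∪ D, ∀ᶠ n in atTop, a ∈ insert 1 ((Finset.range n).image e) := by
    intro a ha
    obtain ⟨N, rfl⟩ : a ∈ range e := he ▸ mem_insert_of_mem _ ha
    filter_upwards [eventually_gt_atTop N] with n hn
    exact Finset.mem_insert_of_mem (Finset.mem_image_of_mem _ (Finset.mem_range.2 hn))
  refine ⟨fun n => insert 1 ((Finset.range n).image e), fun n => Finset.mem_insert_self _ _,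
    fun a ha => hmem a (Or.inl ha), fun t u htu => ?_⟩
  obtain ⟨a, haD, ha⟩ := hD.exists_between htu
  exact (hmem a (Or.inr haD)).mono fun n hn => ⟨a, hn, ha⟩

namespace DSpace

/-- A sequence of grids along which every coordinate may be discretized in every slot of the form
`g`, whatever the other arguments are. -/
theorem exists_grids (g : ContinuousMultilinearMap ℝ (fun _ : Fin k => DSpace m) ℝ) :
    ∃ G : ℕ → Finset unitInterval, ∀ (v : Fin k → DSpace m) (i : Fin k) (j : Fin m),
      Tendsto (fun n => g (Function.update v i
        (compCLM (Function.update (fun _ => none) j (some (G n))) (v i)))) atTop (𝓝 (g v)) := by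
  obtain ⟨A, hA, hright⟩ := (jumpForm_atomBound g).exists_countable_tendsto_right
  obtain ⟨G, hG1, hGA, hGd⟩ := exists_grid_sequence hA
  refine ⟨G, fun v i j => ?_⟩
  set T : ℕ → DSpace m →L[ℝ] DSpace m := fun n =>
    compCLM (Function.update (fun _ => none) j (some (G n))) with hT
  set h : ℕ → ContinuousMultilinearMap ℝ (fun _ : Fin k => DSpace m) ℝ := fun n =>
    g.compContinuousLinearMap fun l =>
      if l = i then T n - ContinuousLinearMap.id ℝ _ else ContinuousLinearMap.id ℝ _ with hh
  have hval : ∀ n (v : Fin k → DSpace m), h n v = g (Function.update v i (T n (v i))) - g v := by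
    intro n v
    have h1 : g v = g (Function.update v i (v i)) := by rw [Function.update_eq_self]
    rw [h1, ← g.map_update_sub, hh, ContinuousMultilinearMap.compContinuousLinearMap_apply]
    congr 1
    ext1 l
    by_cases hl : l = i
    · subst hl; simp
    · simp [hl]
  suffices hz : Tendsto (fun n => h n v) atTop (𝓝 0) by
    simp only [hval] at hz
    simpa using hz.add_const (g v)
  have hnorm : ∀ n, ‖h n‖ ≤ ‖g‖ * ∏ _l : Fin k, 2 := by
    intro n
    refine (g.norm_compContinuousLinearMap_le _).trans ?_
    refine mul_le_mul_of_nonneg_left (Finset.prod_le_prod (fun _ _ => norm_nonneg _) fun l _ => ?_)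
      (norm_nonneg _)
    have hid := ContinuousLinearMap.norm_id_le (𝕜 := ℝ) (E := DSpace m)
    split_ifs
    · have hcomp : ‖T n‖ ≤ 1 := norm_compCLM_le _
      exact (norm_sub_le _ _).trans (by linarith)
    · exact hid.trans one_le_two
  refine ContinuousMultilinearMap.tendsto_zero_of_dense hnorm span_box_dense (fun w hw => ?_) v
  choose τ hτ using hw
  obtain rfl : (fun l => box (τ l)) = w := funext hτ
  simp only [hval]
  rw [tendsto_sub_nhds_zero_iff]
  choose s hs hsG hsx using fun n => exists_le_gridMap_iff (hG1 n) (τ i j)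
  have hbox : ∀ n, T n (box (τ i)) = box (Function.update (τ i) j (s n)) := by
    intro n
    refine DFunLike.ext _ _ fun x => ?_
    rw [hT, compCLM_apply, box_apply, box_apply]
    refine if_congr (forall_congr' fun l => ?_) rfl rfl
    by_cases hl : l = j
    · subst hl
      simpa [coordMap] using hsx n (x l)
    · simp [hl, coordMap]
  have hs_lim : Tendsto s atTop (𝓝 (τ i j)) := by
    refine tendsto_order.2 ⟨fun a ha => Eventually.of_forall fun n => ha.trans_le (hs n),
      fun a ha => ?_⟩
    filter_upwards [hGd _ _ ha] with n ⟨b, hb, hb1, hb2⟩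
    exact (hsG n b hb hb1.le).trans_lt hb2
  have hF : ∀ n, g (Function.update (fun l => box (τ l)) i (box (Function.update (τ i) j (s n)))) =
      jumpForm g fun q => Finsupp.single
        (Function.update (fun q : (_ : Fin k) × Fin m => τ q.1 q.2) ⟨i, j⟩ (s n) q) 1 := by
    intro n
    rw [jumpForm_single]
    congr 1
    ext1 l
    by_cases hl : l = i
    · subst hl
      rw [Function.update_self]
      congr 1
      ext1 r
      by_cases hr : r = j
      · subst hr; simp
      · rw [Function.update_of_ne hr, Function.update_of_ne]
        intro h; exact hr (by simpa using h)
    · rw [Function.update_of_ne hl]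
      congr 1
      ext1 r
      rw [Function.update_of_ne]
      intro h; exact hl (congrArg Sigma.fst h)
  simp only [hbox, hF]
  have hlim : jumpForm g (fun q => Finsupp.single (τ q.1 q.2) 1) = g fun l => box (τ l) :=
    jumpForm_single g fun q => τ q.1 q.2
  rw [← hlim]
  by_cases hmem : τ i j ∈ A
  · -- The jump point belongs to the grids from some point on.
    refine tendsto_const_nhds.congr' ?_
    filter_upwards [hGA _ hmem] with n hn
    have : s n = τ i j := le_antisymm (hsG n _ hn le_rfl) (hs n)
    rw [this]
    congr 1
    ext1 q
    by_cases hq : q = ⟨i, j⟩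
    · subst hq; simp
    · rw [Function.update_of_ne hq]
  · have h1 := hright (fun q => τ q.1 q.2) ⟨i, j⟩ hmem
    set F : unitInterval → ℝ := fun s => jumpForm g fun q => Finsupp.single
        (Function.update (fun q : (_ : Fin k) × Fin m => τ q.1 q.2) ⟨i, j⟩ s q) 1 with hFdef
    have hF0 : jumpForm g (fun q => Finsupp.single (τ q.1 q.2) 1) = F (τ i j) := by
      rw [hFdef]
      congr 1
      ext1 q
      by_cases hq : q = ⟨i, j⟩
      · subst hq; simp
      · rw [Function.update_of_ne hq]
    rw [hF0] at h1 ⊢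
    have h2 : Tendsto F (𝓝[≥] (τ i j)) (𝓝 (F (τ i j))) := by
      rw [← Ioi_insert, nhdsWithin_insert, tendsto_sup]
      exact ⟨tendsto_pure_nhds _ _, h1⟩
    exact h2.comp (tendsto_nhdsWithin_iff.2 ⟨hs_lim, Eventually.of_forall hs⟩)

end DSpace

end Grids

/-! ### Expectations of multilinear forms -/

section Expectation

variable {m k : ℕ} {Ω Ω' : Type*} [MeasurableSpace Ω] [MeasurableSpace Ω']
  {P : Measure Ω} {Q : Measure Ω'} {X : Ω → DSpace m} {Y : Ω' → DSpace m}

lemma integrable_comp_of_abs_le {h : DSpace m → ℝ} (hh : Measurable h) (hX : Measurable X) {C : ℝ}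
    (hb : ∀ f, |h f| ≤ C * ‖f‖ ^ k) {bX : Ω → ℝ} (hbX : Integrable bX P)
    (hXb : ∀ ω, ‖X ω‖ ^ k ≤ bX ω) : Integrable (fun ω => h (X ω)) P := by
  have hC : ∀ ω, ‖h (X ω)‖ ≤ |C| * bX ω := fun ω =>
    (hb _).trans (mul_le_mul (le_abs_self C) (hXb ω) (by positivity) (abs_nonneg C))
  exact (hbX.const_mul |C|).mono' (hh.comp hX).aestronglyMeasurable (Eventually.of_forall hC)

/-- Measurability and equality of expectations are stable under limits dominated by `‖f‖ ^ k`. -/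
lemma measurable_and_integral_eq_of_tendsto {h : ℕ → DSpace m → ℝ} {h' : DSpace m → ℝ}
    (hX : Measurable X) (hY : Measurable Y) {C : ℝ} (hb : ∀ n f, |h n f| ≤ C * ‖f‖ ^ k)
    {bX : Ω → ℝ} (hbX : Integrable bX P) (hXb : ∀ ω, ‖X ω‖ ^ k ≤ bX ω)
    {bY : Ω' → ℝ} (hbY : Integrable bY Q) (hYb : ∀ ω, ‖Y ω‖ ^ k ≤ bY ω)
    (hh : ∀ n, Measurable (h n) ∧ ∫ ω, h n (X ω) ∂P = ∫ ω, h n (Y ω) ∂Q)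
    (hlim : ∀ f, Tendsto (fun n => h n f) atTop (𝓝 (h' f))) :
    Measurable h' ∧ ∫ ω, h' (X ω) ∂P = ∫ ω, h' (Y ω) ∂Q := by
  refine ⟨measurable_of_tendsto_metrizable (fun n => (hh n).1) (tendsto_pi_nhds.2 hlim), ?_⟩
  have h1 : Tendsto (fun n => ∫ ω, h n (X ω) ∂P) atTop (𝓝 (∫ ω, h' (X ω) ∂P)) :=
    tendsto_integral_of_dominated_convergence (fun ω => |C| * bX ω)
      (fun n => ((hh n).1.comp hX).aestronglyMeasurable) (hbX.const_mul _)
      (fun n => Eventually.of_forall fun ω => (hb n _).trans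
        (mul_le_mul (le_abs_self C) (hXb ω) (by positivity) (abs_nonneg C)))
      (Eventually.of_forall fun ω => hlim _)
  have h2 : Tendsto (fun n => ∫ ω, h n (Y ω) ∂Q) atTop (𝓝 (∫ ω, h' (Y ω) ∂Q)) :=
    tendsto_integral_of_dominated_convergence (fun ω => |C| * bY ω)
      (fun n => ((hh n).1.comp hY).aestronglyMeasurable) (hbY.const_mul _)
      (fun n => Eventually.of_forall fun ω => (hb n _).trans
        (mul_le_mul (le_abs_self C) (hYb ω) (by positivity) (abs_nonneg C)))
      (Eventually.of_forall fun ω => hlim _)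
  simp only [(hh _).2] at h1
  exact tendsto_nhds_unique h1 h2

namespace DSpace

lemma measurable_prod_apply (t : Fin k → Cube m) : Measurable fun f : DSpace m => ∏ i, f (t i) :=
  Finset.measurable_prod _ fun i _ => measurable_apply (t i)

lemma abs_prod_apply_le (t : Fin k → Cube m) (f : DSpace m) : |∏ i, f (t i)| ≤ 1 * ‖f‖ ^ k := by
  rw [Finset.abs_prod, one_mul]
  refine (Finset.prod_le_prod (fun _ _ => abs_nonneg _) fun i _ => f.abs_apply_le (t i)).trans ?_
  simp

/-- The indicator function of the set of points that the grids `Γ` round to `p`. -/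
def cell (Γ : Fin m → Finset unitInterval) (p : Cube m) : DSpace m :=
  ofFun (fun x => (fun y => if y = p then 1 else 0) fun j => gridMap (Γ j) (x j))
    (isCadlag_comp_gridMap (fun y => if y = p then 1 else 0) Γ)

lemma cell_apply (Γ : Fin m → Finset unitInterval) (p x : Cube m) :
    cell Γ p x = if (fun j => gridMap (Γ j) (x j)) = p then 1 else 0 := rfl

lemma compCLM_some_eq_sum (Γ : Fin m → Finset unitInterval) (f : DSpace m) :
    compCLM (fun j => some (Γ j)) f = ∑ p ∈ Fintype.piFinset fun j => insert ⊥ (Γ j),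
      f p • cell Γ p := by
  refine DFunLike.ext _ _ fun x => ?_
  rw [sum_apply, Finset.sum_eq_single (fun j => gridMap (Γ j) (x j))]
  · rw [smul_apply, cell_apply, if_pos rfl, mul_one]
    rfl
  · intro p _ hp
    rw [smul_apply, cell_apply, if_neg hp.symm, mul_zero]
  · intro h
    exact absurd (Fintype.mem_piFinset.2 fun j => gridMap_mem (Γ j) (x j)) h

/-- Equality of the product moments of order `k` passes from point evaluations to all `k`-linear
forms on `D([0,1]^m)`. -/
theorem measurable_and_integral_eq (g : ContinuousMultilinearMap ℝ (fun _ : Fin k => DSpace m) ℝ)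
    (hX : Measurable X) (hY : Measurable Y)
    {bX : Ω → ℝ} (hbX : Integrable bX P) (hXb : ∀ ω, ‖X ω‖ ^ k ≤ bX ω)
    {bY : Ω' → ℝ} (hbY : Integrable bY Q) (hYb : ∀ ω, ‖Y ω‖ ^ k ≤ bY ω)
    (hmom : ∀ t : Fin k → Cube m, ∫ ω, ∏ i, X ω (t i) ∂P = ∫ ω, ∏ i, Y ω (t i) ∂Q) :
    Measurable (fun f : DSpace m => g fun _ => f) ∧
      ∫ ω, g (fun _ => X ω) ∂P = ∫ ω, g (fun _ => Y ω) ∂Q := by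
  classical
  obtain ⟨G, hG⟩ := exists_grids g
  have hbound : ∀ (σ : Fin k → Fin m → Option (Finset unitInterval)) (f : DSpace m),
      |g fun i => compCLM (σ i) f| ≤ ‖g‖ * ‖f‖ ^ k := by
    intro σ f
    refine (g.le_opNorm _).trans (mul_le_mul_of_nonneg_left ?_ (norm_nonneg _))
    refine (Finset.prod_le_prod (fun _ _ => norm_nonneg _) fun i _ =>
      (compCLM (σ i)).le_of_opNorm_le (norm_compCLM_le _) f).trans ?_
    simp
  -- Discretize the coordinates one at a time.
  have key : ∀ (c : ℕ) (σ : Fin k → Fin m → Option (Finset unitInterval)),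
      (Finset.univ.filter fun q : Fin k × Fin m => σ q.1 q.2 = none).card = c →
      Measurable (fun f : DSpace m => g fun i => compCLM (σ i) f) ∧
        ∫ ω, g (fun i => compCLM (σ i) (X ω)) ∂P = ∫ ω, g (fun i => compCLM (σ i) (Y ω)) ∂Q := by
    intro c
    induction c with
    | zero =>
      intro σ hσ
      have hsome : ∀ i j, ∃ Γ, σ i j = some Γ := by
        intro i j
        refine Option.ne_none_iff_exists'.1 fun h => ?_
        exact Finset.notMem_empty (i, j)
          (Finset.card_eq_zero.1 hσ ▸ Finset.mem_filter.2 ⟨Finset.mem_univ _, h⟩)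
      choose Γ hΓ using hsome
      obtain rfl : σ = fun i j => some (Γ i j) := by ext1 i; ext1 j; exact hΓ i j
      have hexp : ∃ (T : Finset (Fin k → Cube m)) (a : (Fin k → Cube m) → ℝ), ∀ f : DSpace m,
          g (fun i => compCLM (fun j => some (Γ i j)) f) = ∑ t ∈ T, (∏ i, f (t i)) * a t := by
        refine ⟨Fintype.piFinset fun i => Fintype.piFinset fun j => insert ⊥ (Γ i j),
          fun t => g fun i => cell (Γ i) (t i), fun f => ?_⟩
        simp only [compCLM_some_eq_sum]
        rw [g.map_sum_finset]
        exact Finset.sum_congr rfl fun t _ => g.map_smul_univ _ _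
      obtain ⟨T, a, hT⟩ := hexp
      simp only [hT]
      refine ⟨Finset.measurable_sum _ fun t _ => (measurable_prod_apply t).mul_const _, ?_⟩
      rw [integral_finsetSum _ fun t _ => (integrable_comp_of_abs_le (measurable_prod_apply t) hX
          (abs_prod_apply_le t) hbX hXb).mul_const _,
        integral_finsetSum _ fun t _ => (integrable_comp_of_abs_le (measurable_prod_apply t) hY
          (abs_prod_apply_le t) hbY hYb).mul_const _]
      exact Finset.sum_congr rfl fun t _ => by rw [integral_mul_const, integral_mul_const, hmom]
    | succ c ih =>
      intro σ hσ
      obtain ⟨⟨i, j⟩, hij⟩ := Finset.card_pos.1 (hσ.symm ▸ Nat.succ_pos c :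
        0 < (Finset.univ.filter fun q : Fin k × Fin m => σ q.1 q.2 = none).card)
      have hnone : σ i j = none := (Finset.mem_filter.1 hij).2
      set σ' : ℕ → Fin k → Fin m → Option (Finset unitInterval) := fun n =>
        Function.update σ i (Function.update (σ i) j (some (G n))) with hσ'
      refine measurable_and_integral_eq_of_tendsto (h := fun n f => g fun l => compCLM (σ' n l) f)
        hX hY (fun n => hbound (σ' n)) hbX hXb hbY hYb (fun n => ih (σ' n) ?_) fun f => ?_
      · have : (Finset.univ.filter fun q : Fin k × Fin m => σ' n q.1 q.2 = none) =
            (Finset.univ.filter fun q : Fin k × Fin m => σ q.1 q.2 = none).erase (i, j) := by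
          ext ⟨a, b⟩
          simp only [Finset.mem_filter, Finset.mem_univ, true_and, Finset.mem_erase, ne_eq,
            Prod.mk.injEq, hσ']
          by_cases ha : a = i
          · subst ha
            by_cases hb : b = j
            · subst hb; simp
            · simp [hb]
          · simp [ha]
        rw [this, Finset.card_erase_of_mem hij, hσ, Nat.add_sub_cancel]
      · refine (hG (fun l => compCLM (σ l) f) i j).congr fun n => ?_
        congr 1
        ext1 l
        by_cases hl : l = i
        · subst hl
          rw [Function.update_self]
          refine DFunLike.ext _ _ fun x => ?_
          simp only [compCLM_apply]
          congr 1
          ext1 b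
          by_cases hb : b = j
          · subst hb; simp [hσ', hnone, coordMap]
          · simp [hσ', hb, coordMap]
        · simp [hσ', hl]
  have hid : ∀ f : DSpace m, compCLM (fun _ => none) f = f := fun f => rfl
  simpa only [hid] using key _ (fun _ _ => none) rfl

end DSpace

end Expectation

/-! ### Functions in the Zolotarev class -/

section Taylor

variable {B : Type*} [NormedAddCommGroup B] [NormedSpace ℝ B]

lemma iteratedDeriv_comp_smul {f : B → ℝ} {n : ℕ} (hf : ContDiff ℝ n f) (x : B) {k : ℕ} (hk : k ≤ n)
    (r : ℝ) : iteratedDeriv k (fun r : ℝ => f (r • x)) r =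
      iteratedFDeriv ℝ k f (r • x) fun _ => x := by
  have h := (ContinuousLinearMap.toSpanSingleton ℝ x).iteratedFDeriv_comp_right hf r
    (i := k) (by exact_mod_cast hk)
  rw [iteratedDeriv_eq_iteratedFDeriv]
  change iteratedFDeriv ℝ k (f ∘ ContinuousLinearMap.toSpanSingleton ℝ x) r _ = _
  rw [h]
  simp

/-- **Taylor's theorem** for the Zolotarev class. -/
theorem abs_sub_taylor_le_of_mem_zolotarevClass {s : ℝ} (hs : 0 < s) {f : B → ℝ}
    (hf : f ∈ zolotarevClass B s) (x : B) :
    |f x - ∑ k ∈ Finset.range (⌈s⌉₊ - 1 + 1),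
      (k.factorial : ℝ)⁻¹ * iteratedFDeriv ℝ k f 0 fun _ => x| ≤ ‖x‖ ^ s := by
  obtain ⟨hf, hD⟩ := hf
  have hns : ((⌈s⌉₊ - 1 : ℕ) : ℝ) < s :=
    Nat.lt_ceil.1 (Nat.sub_lt (Nat.ceil_pos.2 hs) one_pos)
  generalize ⌈s⌉₊ - 1 = n at hf hD hns ⊢
  -- The remainder is controlled by the increment of the last derivative along the segment.
  have hinc : ∀ ξ : ℝ, 0 ≤ ξ → ξ ≤ 1 →
      |iteratedFDeriv ℝ n f (ξ • x) (fun _ => x) - iteratedFDeriv ℝ n f 0 fun _ => x| ≤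
        ‖x‖ ^ s := by
    intro ξ h0 h1
    have h2 : ‖ξ • x‖ ≤ ‖x‖ := by
      rw [norm_smul, Real.norm_eq_abs, abs_of_nonneg h0]
      exact mul_le_of_le_one_left (norm_nonneg x) h1
    have h3 := (iteratedFDeriv ℝ n f (ξ • x) - iteratedFDeriv ℝ n f 0).le_of_opNorm_le
      (hD (ξ • x) 0) fun _ => x
    rw [sub_zero, Finset.prod_const, Finset.card_univ, Fintype.card_fin] at h3
    refine h3.trans ?_
    calc ‖ξ • x‖ ^ (s - n) * ‖x‖ ^ n ≤ ‖x‖ ^ (s - n) * ‖x‖ ^ n :=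
          mul_le_mul_of_nonneg_right (Real.rpow_le_rpow (norm_nonneg _) h2 (sub_nonneg.2 hns.le))
            (by positivity)
      _ = ‖x‖ ^ s := by
          rw [← Real.rpow_natCast, ← Real.rpow_add_of_nonneg (norm_nonneg x) (sub_nonneg.2 hns.le)
            (Nat.cast_nonneg n), sub_add_cancel]
  cases n with
  | zero => simpa using hinc 1 zero_le_one le_rfl
  | succ N =>
    set φ : ℝ → ℝ := fun r => f (r • x) with hφ
    have hφc : ContDiff ℝ (N + 1 : ℕ) φ := hf.comp (contDiff_id.smul contDiff_const)
    obtain ⟨ξ, hξ, hT⟩ := taylor_mean_remainder_lagrange_iteratedDeriv (f := φ) (x₀ := 0) (x := 1)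
      (n := N) zero_ne_one (by exact_mod_cast hφc.contDiffOn)
    rw [uIoo_of_lt one_pos] at hξ
    have hu : UniqueDiffOn ℝ (uIcc (0 : ℝ) 1) := uniqueDiffOn_uIcc zero_ne_one
    rw [taylor_within_apply] at hT
    have hsum : ∑ k ∈ Finset.range (N + 1), ((k.factorial : ℝ)⁻¹ * (1 - 0) ^ k) •
        iteratedDerivWithin k φ (uIcc 0 1) 0 =
        ∑ k ∈ Finset.range (N + 1), (k.factorial : ℝ)⁻¹ * iteratedFDeriv ℝ k f 0 fun _ => x := by
      refine Finset.sum_congr rfl fun k hk => ?_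
      have hkN : k ≤ N + 1 := (Finset.mem_range.1 hk).le
      rw [iteratedDerivWithin_eq_iteratedFDerivWithin, iteratedFDerivWithin_eq_iteratedFDeriv hu
        (hφc.contDiffAt.of_le (by exact_mod_cast hkN)) (by simp), ← iteratedDeriv_eq_iteratedFDeriv,
        hφ, iteratedDeriv_comp_smul hf x hkN]
      simp
    rw [hsum, hφ, iteratedDeriv_comp_smul hf x le_rfl] at hT
    rw [Finset.sum_range_succ, ← sub_sub]
    simp only [one_smul] at hT
    have hfac : (1 : ℝ) ≤ ((N + 1).factorial : ℝ) := by
      exact_mod_cast Nat.succ_le_of_lt (Nat.factorial_pos _)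
    rw [hT, sub_zero, one_pow, mul_one, div_eq_inv_mul, ← mul_sub, abs_mul]
    refine (mul_le_of_le_one_left (abs_nonneg _) ?_).trans (hinc ξ hξ.1.le hξ.2.le)
    rw [abs_of_nonneg (by positivity)]
    exact inv_le_one_of_one_le₀ hfac

/-- The derivative of order `n` of a homogeneous polynomial of degree at most `n` is constant. -/
lemma iteratedFDeriv_eq_of_homogeneous {f : B → ℝ} {n l : ℕ} (hl : l ≤ n) (hf : ContDiff ℝ n f)
    (hom : ∀ (c : ℝ) (x : B), f (c • x) = c ^ l * f x) (x y : B) :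
    iteratedFDeriv ℝ n f x = iteratedFDeriv ℝ n f y := by
  suffices h : ∀ (x : B) (v : Fin n → B),
      iteratedFDeriv ℝ n f x v = 0 ^ (n - l) * iteratedFDeriv ℝ n f 0 v by
    ext v
    rw [h x, h y]
  intro x v
  have hscale : ∀ c : ℝ, c ≠ 0 →
      iteratedFDeriv ℝ n f x v = c ^ (n - l) * iteratedFDeriv ℝ n f (c • x) v := by
    intro c hc
    have h1 := (c • ContinuousLinearMap.id ℝ B).iteratedFDeriv_comp_right hf x (i := n) le_rfl
    have h2 : f ∘ (c • ContinuousLinearMap.id ℝ B) = c ^ l • f := by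
      ext y
      simp [hom]
    rw [h2, iteratedFDeriv_const_smul_apply hf.contDiffAt] at h1
    have h3 := congrArg (fun M => M v) h1
    simp only [_root_.smul_apply, smul_eq_mul,
      ContinuousMultilinearMap.compContinuousLinearMap_apply, ContinuousLinearMap.id_apply] at h3
    rw [ContinuousMultilinearMap.map_smul_univ, Finset.prod_const, Finset.card_univ,
      Fintype.card_fin, smul_eq_mul] at h3
    have h4 : c ^ n = c ^ l * c ^ (n - l) := by rw [← pow_add, Nat.add_sub_cancel' hl]
    rw [h4, mul_assoc] at h3
    exact mul_left_cancel₀ (pow_ne_zero l hc) h3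
  have hcont : Continuous fun c : ℝ => c ^ (n - l) * iteratedFDeriv ℝ n f (c • x) v := by
    have h1 : Continuous fun c : ℝ => iteratedFDeriv ℝ n f (c • x) :=
      (hf.continuous_iteratedFDeriv le_rfl).comp (continuous_id.smul continuous_const)
    exact (continuous_id.pow _).mul (h1.eval_const v)
  have h0 : Tendsto (fun c : ℝ => c ^ (n - l) * iteratedFDeriv ℝ n f (c • x) v) (𝓝[≠] 0)
      (𝓝 (0 ^ (n - l) * iteratedFDeriv ℝ n f 0 v)) := by
    have := (hcont.tendsto 0).mono_left (nhdsWithin_le_nhds (s := {0}ᶜ))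
    simpa using this
  refine tendsto_nhds_unique (tendsto_const_nhds.congr' ?_) h0
  filter_upwards [self_mem_nhdsWithin] with c hc
  exact hscale c hc

end Taylor

lemma DSpace.const_mul_prod_mem_zolotarevClass {m : ℕ} {s : ℝ} {l : ℕ} (hl : (l : ℝ) < s)
    (t : Fin l → Cube m) (c : ℝ) :
    (fun f : DSpace m => c * ∏ i, f (t i)) ∈ zolotarevClass (DSpace m) s := by
  have hln : l ≤ ⌈s⌉₊ - 1 := Nat.le_sub_one_of_lt (Nat.lt_ceil.2 hl)
  have hns : ((⌈s⌉₊ - 1 : ℕ) : ℝ) ≤ s := by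
    have h := Nat.lt_ceil.1 (Nat.sub_lt (Nat.ceil_pos.2 ((Nat.cast_nonneg l).trans_lt hl)) one_pos)
    exact h.le
  have hcd : ∀ n : ℕ, ContDiff ℝ n fun f : DSpace m => c * ∏ i, f (t i) := fun n =>
    contDiff_const.mul (contDiff_prod fun i _ => (DSpace.evalCLM (t i)).contDiff)
  refine ⟨hcd _, fun x y => ?_⟩
  rw [iteratedFDeriv_eq_of_homogeneous hln (hcd _) (fun a f => ?_) x y, sub_self, norm_zero]
  · positivity
  · simp only [DSpace.smul_apply, Finset.prod_mul_distrib, Finset.prod_const, Finset.card_univ,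
      Fintype.card_fin]
    ring

lemma pow_le_one_add_rpow {a s : ℝ} (ha : 0 ≤ a) {k : ℕ} (hk : (k : ℝ) ≤ s) :
    a ^ k ≤ 1 + a ^ s := by
  rcases le_total a 1 with h | h
  · exact (pow_le_one₀ ha h).trans (le_add_of_nonneg_right (Real.rpow_nonneg ha s))
  · rw [← Real.rpow_natCast]
    exact (Real.rpow_le_rpow_of_exponent_le h hk).trans (le_add_of_nonneg_left zero_le_one)

end

/-! ### Finiteness of the Zolotarev distance -/

theorem theorem9p2 {Ω Ω' : Type*} [MeasurableSpace Ω] [MeasurableSpace Ω']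
    (P : Measure Ω) [IsProbabilityMeasure P] (Q : Measure Ω') [IsProbabilityMeasure Q]
    (m : ℕ) (hm : 1 ≤ m) (s : ℝ) (hs : 0 < s)
    (X : Ω → DSpace m) (hX : Measurable X) (Y : Ω' → DSpace m) (hY : Measurable Y)
    (hXs : Integrable (fun ω => ‖X ω‖ ^ s) P) (hYs : Integrable (fun ω => ‖Y ω‖ ^ s) Q) :
    zolotarevDist s P X Q Y < ∞ ↔
      ∀ ℓ : ℕ, 0 < ℓ → (ℓ : ℝ) < s → ∀ t : Fin ℓ → Cube m,
        ∫ ω, ∏ i, X ω (t i) ∂P = ∫ ω, ∏ i, Y ω (t i) ∂Q := by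
  have hbX : Integrable (fun ω => 1 + ‖X ω‖ ^ s) P := (integrable_const 1).add hXs
  have hbY : Integrable (fun ω => 1 + ‖Y ω‖ ^ s) Q := (integrable_const 1).add hYs
  have hXb : ∀ k : ℕ, (k : ℝ) ≤ s → ∀ ω, ‖X ω‖ ^ k ≤ 1 + ‖X ω‖ ^ s := fun k hk ω =>
    pow_le_one_add_rpow (norm_nonneg _) hk
  have hYb : ∀ k : ℕ, (k : ℝ) ≤ s → ∀ ω, ‖Y ω‖ ^ k ≤ 1 + ‖Y ω‖ ^ s := fun k hk ω =>
    pow_le_one_add_rpow (norm_nonneg _) hk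
  constructor
  · intro hfin ℓ _ hℓs t
    by_contra hne
    set d : ℝ := ∫ ω, ∏ i, X ω (t i) ∂P - ∫ ω, ∏ i, Y ω (t i) ∂Q with hd
    have hd0 : d ≠ 0 := sub_ne_zero.2 hne
    have hXi := integrable_comp_of_abs_le (DSpace.measurable_prod_apply t) hX
      (DSpace.abs_prod_apply_le t) hbX (hXb ℓ hℓs.le)
    have hYi := integrable_comp_of_abs_le (DSpace.measurable_prod_apply t) hY
      (DSpace.abs_prod_apply_le t) hbY (hYb ℓ hℓs.le)
    -- All multiples of the monomial belong to the class, so its expectations cannot differ.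
    have hle : ∀ c : ℝ, ENNReal.ofReal |c * d| ≤ zolotarevDist s P X Q Y := by
      intro c
      have h := le_iSup₂ (f := fun (f : DSpace m → ℝ) (_ : f ∈ {f ∈ zolotarevClass (DSpace m) s |
          Integrable (fun ω => f (X ω)) P ∧ Integrable (fun ω => f (Y ω)) Q}) =>
          ENNReal.ofReal |∫ ω, f (X ω) ∂P - ∫ ω, f (Y ω) ∂Q|) (fun f => c * ∏ i, f (t i))
        ⟨DSpace.const_mul_prod_mem_zolotarevClass hℓs t c, hXi.const_mul c, hYi.const_mul c⟩
      simp only [integral_const_mul, ← mul_sub] at h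
      exact h
    have h1 := hle (((zolotarevDist s P X Q Y).toReal + 1) / d)
    rw [div_mul_cancel₀ _ hd0, abs_of_nonneg (by positivity),
      ENNReal.ofReal_le_iff_le_toReal hfin.ne] at h1
    linarith
  · intro hmom
    refine lt_of_le_of_lt (iSup₂_le fun f hf => ENNReal.ofReal_le_ofReal ?_)
      (ENNReal.ofReal_lt_top (r := ∫ ω, ‖X ω‖ ^ s ∂P + ∫ ω, ‖Y ω‖ ^ s ∂Q))
    obtain ⟨hfs, hfX, hfY⟩ := hf
    have htay := abs_sub_taylor_le_of_mem_zolotarevClass hs hfs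
    set T : DSpace m → ℝ := fun x => ∑ k ∈ Finset.range (⌈s⌉₊ - 1 + 1),
      (k.factorial : ℝ)⁻¹ * iteratedFDeriv ℝ k f 0 fun _ => x with hT
    have hks : ∀ k ∈ Finset.range (⌈s⌉₊ - 1 + 1), (k : ℝ) < s := by
      intro k hk
      rw [Nat.sub_add_cancel (Nat.ceil_pos.2 hs)] at hk
      exact Nat.lt_ceil.1 (Finset.mem_range.1 hk)
    have hk : ∀ k ∈ Finset.range (⌈s⌉₊ - 1 + 1),
        Measurable (fun x : DSpace m => iteratedFDeriv ℝ k f 0 fun _ => x) ∧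
        ∫ ω, iteratedFDeriv ℝ k f 0 (fun _ => X ω) ∂P =
          ∫ ω, iteratedFDeriv ℝ k f 0 (fun _ => Y ω) ∂Q := by
      intro k hk
      refine DSpace.measurable_and_integral_eq _ hX hY hbX (hXb k (hks k hk).le) hbY
        (hYb k (hks k hk).le) fun t => ?_
      rcases Nat.eq_zero_or_pos k with rfl | h0
      · simp
      · exact hmom k h0 (hks k hk) t
    have hbd : ∀ (k : ℕ) (x : DSpace m),
        |iteratedFDeriv ℝ k f 0 fun _ => x| ≤ ‖iteratedFDeriv ℝ k f 0‖ * ‖x‖ ^ k := by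
      intro k x
      simpa using (iteratedFDeriv ℝ k f 0).le_opNorm fun _ => x
    have hTX : ∀ k ∈ Finset.range (⌈s⌉₊ - 1 + 1), Integrable (fun ω =>
        (k.factorial : ℝ)⁻¹ * iteratedFDeriv ℝ k f 0 fun _ => X ω) P := fun k h =>
      (integrable_comp_of_abs_le (hk k h).1 hX (hbd k) hbX (hXb k (hks k h).le)).const_mul _
    have hTY : ∀ k ∈ Finset.range (⌈s⌉₊ - 1 + 1), Integrable (fun ω =>
        (k.factorial : ℝ)⁻¹ * iteratedFDeriv ℝ k f 0 fun _ => Y ω) Q := fun k h =>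
      (integrable_comp_of_abs_le (hk k h).1 hY (hbd k) hbY (hYb k (hks k h).le)).const_mul _
    have hTeq : ∫ ω, T (X ω) ∂P = ∫ ω, T (Y ω) ∂Q := by
      simp only [hT]
      rw [integral_finsetSum _ hTX, integral_finsetSum _ hTY]
      exact Finset.sum_congr rfl fun k h => by
        rw [integral_const_mul, integral_const_mul, (hk k h).2]
    have hTXi : Integrable (fun ω => T (X ω)) P := integrable_finsetSum _ hTX
    have hTYi : Integrable (fun ω => T (Y ω)) Q := integrable_finsetSum _ hTY
    have hsplit : ∫ ω, f (X ω) ∂P - ∫ ω, f (Y ω) ∂Q =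
        ∫ ω, (f (X ω) - T (X ω)) ∂P - ∫ ω, (f (Y ω) - T (Y ω)) ∂Q := by
      rw [integral_sub hfX hTXi, integral_sub hfY hTYi, hTeq]
      ring
    rw [hsplit]
    refine (abs_sub _ _).trans (add_le_add ?_ ?_)
    · exact norm_integral_le_of_norm_le (f := fun ω => f (X ω) - T (X ω)) hXs
        (Eventually.of_forall fun ω => htay (X ω))
    · exact norm_integral_le_of_norm_le (f := fun ω => f (Y ω) - T (Y ω)) hYs
        (Eventually.of_forall fun ω => htay (Y ω))
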